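/- Let $n\ge 1$ and $1\le k\le n$ be integers, and let $p>1$, $\beta<p-1$, $\alpha$ and $d\ge 0$ be real numbers. Put $f(t)=t^d$ for $t>0$ and $f(t)=0$ for $t\le 0$. For $\lambda=(\lambda_1,\dots,\lambda_n)\in\mathbb R^n$ let $$S_k(\lambda)=\sum_{i_1<\dots<i_k}\lambda_{i_1}\cdots\lambda_{i_k},\qquad \Pi_k(\lambda)=\prod_{i_1<\dots<i_k}(\lambda_{i_1}+\dots+\lambda_{i_k}),$$ $$\Gamma_k=\{\lambda: S_i(\lambda)>0,\ i=1,\dots,k\},\qquad \mathcal P_k=\{\lambda:\lambda_{i_1}+\dots+\lambda_{i_k}>0 \text{ for all } i_1<\dots<i_k\},$$ and apply $S_k$, $\Pi_k$ to a matrix through its eigenvalues $\lambda(\cdot)$. Consider in $\mathbb R^n$ the equations $$(1)\quad S_k^{1/k}[D(|Du|^{p-2}Du)]=|x|^\alpha|Du|^\beta f(u),\qquad (2)\quad \Pi_k^{1/\binom nk}[D(|Du|^{p-2}Du)]=|x|^\alpha|Du|^\beta f(u).$$ An *entire admissible subsolution* of (1) (resp. (2)) is a function $u\in C^1(\mathbb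 R^n)\cap C^2(\mathbb R^n\setminus\{0\})$ such that: * if $p\le\alpha+\beta+2$, then $u\in C^2(\mathbb R^n)$; if $p>\alpha+\beta+2$ and $(p-1)\alpha+\beta\ge 0$, then $u\in W^{2,\delta}_{loc}(\mathbb R^n)$ for all $\delta\in\bigl(1,\frac{p-\beta-1}{p-\alpha-\beta-2}\bigr)$; * the field $|Du|^{p-2}Du$ (equal to $0$ where $Du=0$) is $C^1$ on $\mathbb R^n\setminus\{0\}$, and on $\mathbb R^n$ if $(p-1)\alpha+\beta\ge 0$; * at every $x\ne 0$, and also at $x=0$ if $\alpha=\beta=0$, one has $\lambda(D(|Du|^{p-2}Du))\in\Gamma_k$ (resp. $\in\mathcal P_k$), and the left-hand side of the equation is $\ge|x|^\alpha|Du|^\beta f(u)$, where for $\beta<0$ the right-hand side counts as $+\infty$ if $x\neq 0$, $Du(x)=0$ and $f(u(x))>0$. Put $c=\frac1k-1$ for equation (1) and $c=\frac kn-1$ for equation (2), and assume that one of the following holds: * $\alpha\ge c$, and either $p\le\alpha+\beta+2$, or $p>\alpha+\beta+2$ and $(p-1)\alpha+\beta\ge0$; * $-1<\alpha<c$. Then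 equation (1) (resp. (2)) has an entire admissible subsolution $u$ with $u\ge 0$ and $u\not\equiv 0$ if and only if $$d\le p-\beta-1.$$ -/

import Mathlib

open MeasureTheory
open scoped ContDiff

noncomputable section

namespace HessianSub

/-- Euclidean space `ℝⁿ`. -/
abbrev E (n : ℕ) : Type := EuclideanSpace ℝ (Fin n)

/-- The `p`-gradient field `|Du|^{p-2} Du`; it vanishes at the critical points of `u`
(the continuous value there, since `p > 1`). -/
def pGrad {n : ℕ} (p : ℝ) (u : E n → ℝ) (x : E n) : E n :=
  ‖gradient u x‖ ^ (p - 2) • gradient u x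

/-- `λ(D(|Du|^{p-2}Du))(x)`: the real eigenvalues of the derivative at `x` of the `p`-gradient
field, with algebraic multiplicity. All `n` eigenvalues are real iff this multiset
has `n` elements. -/
def pHessEigenvalues {n : ℕ} (p : ℝ) (u : E n → ℝ) (x : E n) : Multiset ℝ :=
  (LinearMap.charpoly (fderiv ℝ (pGrad p u) x : E n →ₗ[ℝ] E n)).roots

/-- The Gårding cone `Γ_k` (of unordered `n`-tuples): `S_i(λ) > 0` for `i = 1, …, k`,
where `S_i` is the `i`-th elementary symmetric polynomial. -/
def gardingCone (n k : ℕ) : Set (Multiset ℝ) :=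
  {l | Multiset.card l = n ∧ ∀ i : ℕ, 1 ≤ i → i ≤ k → 0 < l.esymm i}

/-- The cone `P_k` (of unordered `n`-tuples): all sums of `k` entries (with distinct indices)
are positive. -/
def sumCone (n k : ℕ) : Set (Multiset ℝ) :=
  {l | Multiset.card l = n ∧ ∀ s ∈ l.powersetCard k, 0 < s.sum}

/-- The normalized `k`-Hessian operator `S_k(λ)^{1/k}`. -/
def hessOp (k : ℕ) (l : Multiset ℝ) : ℝ :=
  l.esymm k ^ (1 / (k : ℝ))

/-- The normalized `Π_k`-Hessian operator `Π_k(λ)^{1/C_n^k}`, where `Π_k(λ)` is the product of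
all sums of `k` entries with distinct indices. -/
def piOp (n k : ℕ) (l : Multiset ℝ) : ℝ :=
  ((l.powersetCard k).map Multiset.sum).prod ^ (1 / (n.choose k : ℝ))

/-- `u ∈ L^δ_loc(ℝⁿ)`. -/
def MemLpLoc {n : ℕ} (u : E n → ℝ) (δ : ℝ) : Prop :=
  ∀ K : Set (E n), IsCompact K → MemLp u (ENNReal.ofReal δ) (volume.restrict K)

/-- `w` is the weak partial derivative `∂_i u` on `ℝⁿ`, for locally integrable `u`, `w`. -/
def IsWeakPartial {n : ℕ} (i : Fin n) (u w : E n → ℝ) : Prop :=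
  ∀ φ : E n → ℝ, ContDiff ℝ ∞ φ → HasCompactSupport φ →
    ∫ x, u x * fderiv ℝ φ x (EuclideanSpace.single i 1) = - ∫ x, w x * φ x

/-- `u ∈ W^{2,δ}_loc(ℝⁿ)` (used for `δ > 1`). -/
def MemW2Loc {n : ℕ} (u : E n → ℝ) (δ : ℝ) : Prop :=
  MemLpLoc u δ ∧
  ∃ (g : Fin n → E n → ℝ) (h : Fin n → Fin n → E n → ℝ),
    (∀ i, MemLpLoc (g i) δ ∧ IsWeakPartial i u (g i)) ∧
    (∀ i j, MemLpLoc (h i j) δ ∧ IsWeakPartial j (g i) (h i j))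

/-- The power nonlinearity: `t^d` for `t > 0`, and `0` for `t ≤ 0`. -/
def powerNonlin (d t : ℝ) : ℝ := if 0 < t then t ^ d else 0

/-- The regularity class of entire subsolutions, depending on `p, α, β`. -/
structure EntireRegularity {n : ℕ} (p α β : ℝ) (u : E n → ℝ) : Prop where
  contDiff_one : ContDiff ℝ 1 u
  contDiffOn_two : ContDiffOn ℝ 2 u {0}ᶜ
  contDiff_two : p ≤ α + β + 2 → ContDiff ℝ 2 u
  sobolev : α + β + 2 < p → 0 ≤ (p - 1) * α + β →
    ∀ δ : ℝ, 1 < δ → δ < (p - β - 1) / (p - α - β - 2) → MemW2Loc u δ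
  pGrad_contDiffOn : ContDiffOn ℝ 1 (pGrad p u) {0}ᶜ
  pGrad_contDiff : 0 ≤ (p - 1) * α + β → ContDiff ℝ 1 (pGrad p u)

/-- `u` is an entire admissible subsolution of
`F(λ(D(|Du|^{p-2}Du))) = |x|^α |Du|^β f(u)` in `ℝⁿ`, admissible meaning that the
eigenvalues lie in `cone`. If `(α, β) ≠ (0, 0)`, the equation is degenerate or singular
at the origin, and there only the regularity is required. The field `rhs_finite` makes the
convention `0^β = +∞` for `β < 0` explicit: a subsolution has no critical point
where `f(u) > 0` in this case. -/
structure IsEntireAdmissibleSubsolution {n : ℕ} (p α β : ℝ) (f : ℝ → ℝ)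
    (cone : Set (Multiset ℝ)) (F : Multiset ℝ → ℝ) (u : E n → ℝ) : Prop where
  regular : EntireRegularity p α β u
  admissible : ∀ x : E n, (x ≠ 0 ∨ (α = 0 ∧ β = 0)) → pHessEigenvalues p u x ∈ cone
  rhs_finite : ∀ x : E n, x ≠ 0 → β < 0 → 0 < f (u x) → gradient u x ≠ 0
  subsolution : ∀ x : E n, (x ≠ 0 ∨ (α = 0 ∧ β = 0)) →
    ‖x‖ ^ α * ‖gradient u x‖ ^ β * f (u x) ≤ F (pHessEigenvalues p u x)

/-- Existence of a nonnegative nontrivial (not identically zero) entire admissible subsolution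
in `ℝⁿ`. -/
def HasNonnegNontrivialSubsolution (n : ℕ) (p α β : ℝ) (f : ℝ → ℝ)
    (cone : Set (Multiset ℝ)) (F : Multiset ℝ → ℝ) : Prop :=
  ∃ u : E n → ℝ, IsEntireAdmissibleSubsolution p α β f cone F u ∧
    (∀ x, 0 ≤ u x) ∧ ∃ x, u x ≠ 0

/-- The conditions on `α, β, p` (beyond `p > 1` and `β < p - 1`), with threshold exponent
`c`: either `α ≥ c` together with one of the two alternatives
`p ≤ α + β + 2`, or `p > α + β + 2` and `(p - 1)α + β ≥ 0`; or `-1 < α < c`. -/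
def ExponentCondition (c p α β : ℝ) : Prop :=
  (c ≤ α ∧ (p ≤ α + β + 2 ∨ (α + β + 2 < p ∧ 0 ≤ (p - 1) * α + β))) ∨ (-1 < α ∧ α < c)

end HessianSub

end

/-! Every alternative of the exponent condition gives `α > -1`, and both implications run on that.

Necessity. On either cone the operator is at most a constant times the trace, and the trace is
positive. So a subsolution is strictly `p`-subharmonic off the origin and satisfies Δ_p u ≥ c |x|^α
|Du|^β u^d where u > 0. If d > p - 1 - β, a Keller–Osserman comparison forces u = 0. On the ball of
radius R take a radial barrier v that equals `lam` on the inner half-ball and blows up on the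
boundary sphere; it is a supersolution on the outer annulus once lam^(d-(p-1-β)) ≥ K R^(-(p-β+α)).
Suppose u - v has a positive maximum at x₀. If |x₀| < R/2, then u has a local maximum, excluded by
the maximum principle (`IsPSubharmonicOffZero.not_isLocalMax`). If |x₀| = R/2, then x₀ is critical
for u; positivity of Δ_p u makes u grow at least like t^(p/(p-1)) in some direction, faster than v,
which is flat to order m there (`not_isLocalMax_sub_of_critical`). If |x₀| > R/2, comparing second
derivatives (`pLaplacian_le_of_touching`) contradicts the two inequalities. Hence u ≤ `lam` on the
half-ball (`IsPSubharmonicOffZero.le_barrier`), and `lam` can be taken to tend to 0 as R → ∞ because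
p - β + α > 0. Keeping v constant on the half-ball keeps the weight |x|^α away from its singular
point.

Sufficiency. If d ≤ p - 1 - β, the function u = exp(a|x|^μ) with (μ-1)(p-1-β) = α+1 works. Its
`p`-gradient is a radial field of the same exponential type, whose derivative is symmetric and
positive definite off the origin. Both operators are at least the smallest eigenvalue there, and the
choice of μ matches the powers of |x| on the two sides. The regularity thresholds in p, α, β are
exactly the thresholds for μ and for the exponent of the field. -/

noncomputable section

namespace HessianSub

/-! ### Symmetric functions on the two cones: bounds by the trace and by the least entry. -/

section Multiset

theorem pow_card_le_multiset_prod {m : ℝ} (hm : 0 ≤ m) (s : Multiset ℝ) (h : ∀ x ∈ s, m ≤ x) :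
    m ^ Multiset.card s ≤ s.prod := by
  induction s using Multiset.induction with
  | empty => simp
  | cons a s ih =>
    have h1 := ih fun x hx => h x (Multiset.mem_cons_of_mem hx)
    have h2 := h a (Multiset.mem_cons_self a s)
    rw [Multiset.card_cons, Multiset.prod_cons, pow_succ, mul_comm]
    exact mul_le_mul h2 h1 (by positivity) (hm.trans h2)

theorem abs_multiset_prod_le_pow_card {M : ℝ} (s : Multiset ℝ) (h : ∀ x ∈ s, |x| ≤ M) :
    |s.prod| ≤ M ^ Multiset.card s := by
  induction s using Multiset.induction with
  | empty => simp
  | cons a s ih =>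
    have h1 := ih fun x hx => h x (Multiset.mem_cons_of_mem hx)
    have h2 := h a (Multiset.mem_cons_self a s)
    rw [Multiset.card_cons, Multiset.prod_cons, pow_succ, mul_comm, abs_mul, mul_comm]
    rw [mul_comm]
    exact mul_le_mul h1 h2 (abs_nonneg _) ((abs_nonneg _).trans h1)

theorem esymm_two_cons (a : ℝ) (s : Multiset ℝ) :
    (a ::ₘ s).esymm 2 = s.esymm 2 + a * s.sum := by
  have h := Multiset.sum_map_mul_left (s := s) (a := a) (f := id)
  simp only [id, Multiset.map_id'] at h
  simp [Multiset.esymm, Multiset.powersetCard_cons, Multiset.powersetCard_one, h]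

theorem sum_sq_eq_sq_sum_sub_esymm (s : Multiset ℝ) :
    (s.map (· ^ 2)).sum = s.sum ^ 2 - 2 * s.esymm 2 := by
  induction s using Multiset.induction with
  | empty => simp [Multiset.esymm, Multiset.powersetCard_zero_right 1]
  | cons a s ih =>
    rw [esymm_two_cons, Multiset.map_cons, Multiset.sum_cons, Multiset.sum_cons, ih]
    ring

theorem esymm_one_eq_sum (s : Multiset ℝ) : s.esymm 1 = s.sum := by
  simp [Multiset.esymm, Multiset.powersetCard_one]

/-- The sum of squares is S₁² - 2S₂ < S₁², so no single square exceeds S₁². -/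
theorem abs_le_sum_of_esymm_two_pos {s : Multiset ℝ} (h1 : 0 < s.esymm 1) (h2 : 0 < s.esymm 2)
    {x : ℝ} (hx : x ∈ s) : |x| ≤ s.sum := by
  rw [esymm_one_eq_sum] at h1
  have h3 : x ^ 2 ≤ (s.map (· ^ 2)).sum :=
    Multiset.single_le_sum (by simp only [Multiset.mem_map]; rintro _ ⟨y, -, rfl⟩; positivity) _
      (Multiset.mem_map_of_mem (· ^ 2) hx)
  rw [sum_sq_eq_sq_sum_sub_esymm] at h3
  exact abs_le_of_sq_le_sq (by linarith) h1.le

/-- For k ≥ 2 positivity of S₂ bounds every entry by S₁ in absolute value, so each of the C(n,k)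
products is at most S₁^k. This crude form of Maclaurin's inequality suffices. The case k = 1 is
separate because S₂ then has no sign. -/
theorem hessOp_le_sum {n k : ℕ} (hk : 1 ≤ k) {l : Multiset ℝ} (hl : l ∈ gardingCone n k) :
    0 < l.sum ∧ hessOp k l ≤ (n.choose k : ℝ) ^ (1 / (k : ℝ)) * l.sum := by
  obtain ⟨hc, hpos⟩ := hl
  have h1 := hpos 1 le_rfl hk
  have hs : 0 < l.sum := by rwa [esymm_one_eq_sum] at h1
  refine ⟨hs, ?_⟩
  have hk0 : (k : ℝ) ≠ 0 := by positivity
  have key : l.esymm k ≤ (n.choose k : ℝ) * l.sum ^ k := by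
    rcases hk.eq_or_lt with rfl | hk2
    · rw [esymm_one_eq_sum, Nat.choose_one_right, pow_one]
      have hn : 1 ≤ n := by
        rw [← hc, Nat.one_le_iff_ne_zero]
        intro h0
        rw [Multiset.card_eq_zero] at h0
        simp [h0] at hs
      have : (1 : ℝ) ≤ n := by exact_mod_cast hn
      nlinarith
    · have h2 := hpos 2 (by norm_num) hk2
      have := Multiset.sum_le_card_nsmul ((l.powersetCard k).map Multiset.prod) (l.sum ^ k) (by
        simp only [Multiset.mem_map, Multiset.mem_powersetCard]
        rintro _ ⟨t, ⟨ht, htc⟩, rfl⟩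
        rw [← htc]
        exact (le_abs_self _).trans (abs_multiset_prod_le_pow_card t fun x hx =>
          abs_le_sum_of_esymm_two_pos h1 h2 (Multiset.mem_of_le ht hx)))
      simpa [Multiset.esymm, Multiset.card_powersetCard, hc] using this
  calc hessOp k l ≤ ((n.choose k : ℝ) * l.sum ^ k) ^ (1 / (k : ℝ)) :=
        Real.rpow_le_rpow (hpos k hk le_rfl).le key (by positivity)
    _ = (n.choose k : ℝ) ^ (1 / (k : ℝ)) * l.sum := by
        rw [Real.mul_rpow (by positivity) (by positivity), ← Real.rpow_natCast,
          ← Real.rpow_mul hs.le, mul_one_div_cancel hk0, Real.rpow_one]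

theorem sum_map_cons_sum (a : ℝ) (S : Multiset (Multiset ℝ)) :
    ((S.map (Multiset.cons a)).map Multiset.sum).sum
      = Multiset.card S * a + (S.map Multiset.sum).sum := by
  induction S using Multiset.induction with
  | empty => simp
  | cons b S ih =>
    simp only [Multiset.map_cons, Multiset.sum_cons, ih, Multiset.card_cons]
    push_cast; ring

/-- Double counting: each entry belongs to C(card - 1, k) of the (k+1)-element selections. -/
theorem sum_powersetCard_sum (l : Multiset ℝ) (k : ℕ) :
    ((l.powersetCard (k + 1)).map Multiset.sum).sum
      = ((Multiset.card l - 1).choose k : ℝ) * l.sum := by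
  induction l using Multiset.induction generalizing k with
  | empty => simp [Multiset.powersetCard_zero_right k]
  | cons a l ih =>
    rw [Multiset.powersetCard_cons, Multiset.map_add, Multiset.sum_add, ih, sum_map_cons_sum,
      Multiset.card_powersetCard, Multiset.sum_cons, Multiset.card_cons, Nat.add_sub_cancel]
    rcases Nat.eq_zero_or_pos (Multiset.card l) with h | h
    · rw [Multiset.card_eq_zero] at h
      subst h
      cases k with
      | zero => simp [Multiset.powersetCard_zero_left]
      | succ j => simp [Multiset.powersetCard_zero_right j]
    · obtain ⟨m, hm⟩ := Nat.exists_eq_add_of_le' h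
      rw [hm, Nat.add_sub_cancel]
      cases k with
      | zero => simp; ring
      | succ k =>
        rw [ih, hm, Nat.add_sub_cancel, Nat.choose_succ_succ]
        push_cast; ring

/-- The k-sums are positive, so each is at most their total, a multiple of the trace by double
counting. Hence so is their geometric mean, which is `piOp`. -/
theorem piOp_le_sum {n k : ℕ} (hk : 1 ≤ k) (hkn : k ≤ n) {l : Multiset ℝ} (hl : l ∈ sumCone n k) :
    0 < l.sum ∧ piOp n k l ≤ ((n - 1).choose (k - 1) : ℝ) * l.sum := by
  obtain ⟨hc, hpos⟩ := hl
  obtain ⟨j, rfl⟩ := Nat.exists_eq_add_of_le' hk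
  have hsum := sum_powersetCard_sum l j
  rw [hc] at hsum
  have hchoose : 0 < n.choose (j + 1) := Nat.choose_pos hkn
  set T := (l.powersetCard (j + 1)).map Multiset.sum with hT
  have hTpos : ∀ x ∈ T, 0 < x := by
    simp only [hT, Multiset.mem_map]
    rintro _ ⟨t, ht, rfl⟩
    exact hpos t ht
  have hTc : Multiset.card T = n.choose (j + 1) := by
    rw [hT, Multiset.card_map, Multiset.card_powersetCard, hc]
  have hle : ∀ x ∈ T, x ≤ T.sum := fun x hx =>
    Multiset.single_le_sum (fun y hy => (hTpos y hy).le) x hx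
  have hTs : 0 < T.sum := by
    obtain ⟨x, hx⟩ := Multiset.card_pos_iff_exists_mem.mp (hTc ▸ hchoose)
    exact (hTpos x hx).trans_le (hle x hx)
  refine ⟨?_, ?_⟩
  · rw [hsum] at hTs
    exact pos_of_mul_pos_right hTs (by positivity)
  · rw [Nat.add_sub_cancel, ← hsum]
    have hp := abs_multiset_prod_le_pow_card T (M := T.sum) fun x hx => by
      rw [abs_of_pos (hTpos x hx)]; exact hle x hx
    have h0 : (0 : ℝ) ≤ T.prod := Multiset.prod_nonneg fun x hx => (hTpos x hx).le
    rw [abs_of_nonneg h0, hTc] at hp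
    have hcr : ((n.choose (j + 1) : ℕ) : ℝ) ≠ 0 := by positivity
    calc piOp n (j + 1) l ≤ (T.sum ^ n.choose (j + 1)) ^ (1 / (n.choose (j + 1) : ℝ)) :=
          Real.rpow_le_rpow h0 hp (by positivity)
      _ = T.sum := by
          rw [← Real.rpow_natCast, ← Real.rpow_mul hTs.le, mul_one_div_cancel hcr, Real.rpow_one]

theorem pow_le_esymm {m : ℝ} (hm : 0 < m) {l : Multiset ℝ} (h : ∀ x ∈ l, m ≤ x) {i : ℕ}
    (hi : i ≤ Multiset.card l) : m ^ i ≤ l.esymm i := by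
  have h1 := Multiset.card_nsmul_le_sum (s := (l.powersetCard i).map Multiset.prod) (a := m ^ i) (by
    simp only [Multiset.mem_map, Multiset.mem_powersetCard]
    rintro _ ⟨t, ⟨ht, htc⟩, rfl⟩
    rw [← htc]
    exact pow_card_le_multiset_prod hm.le t fun x hx => h x (Multiset.mem_of_le ht hx))
  rw [Multiset.card_map, Multiset.card_powersetCard, nsmul_eq_mul] at h1
  have h2 : (1 : ℝ) ≤ ((Multiset.card l).choose i : ℕ) := by
    exact_mod_cast Nat.choose_pos hi
  exact (le_mul_of_one_le_left (by positivity) h2).trans h1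

theorem mem_gardingCone_of_le {n k : ℕ} (hk : 1 ≤ k) (hkn : k ≤ n) {m : ℝ} (hm : 0 < m)
    {l : Multiset ℝ} (hc : Multiset.card l = n) (h : ∀ x ∈ l, m ≤ x) :
    l ∈ gardingCone n k ∧ m ≤ hessOp k l := by
  refine ⟨⟨hc, fun i _ hi => (pow_pos hm i).trans_le (pow_le_esymm hm h (by omega))⟩, ?_⟩
  have hk0 : (k : ℝ) ≠ 0 := by positivity
  calc m = (m ^ k) ^ (1 / (k : ℝ)) := by
        rw [← Real.rpow_natCast, ← Real.rpow_mul hm.le, mul_one_div_cancel hk0, Real.rpow_one]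
    _ ≤ hessOp k l :=
        Real.rpow_le_rpow (by positivity) (pow_le_esymm hm h (by omega)) (by positivity)

theorem mem_sumCone_of_le {n k : ℕ} (hk : 1 ≤ k) (hkn : k ≤ n) {m : ℝ} (hm : 0 < m)
    {l : Multiset ℝ} (hc : Multiset.card l = n) (h : ∀ x ∈ l, m ≤ x) :
    l ∈ sumCone n k ∧ m ≤ piOp n k l := by
  have hs : ∀ s ∈ l.powersetCard k, m ≤ s.sum := by
    intro s hs
    rw [Multiset.mem_powersetCard] at hs
    have h1 := Multiset.card_nsmul_le_sum (s := s) (a := m) fun x hx =>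
      h x (Multiset.mem_of_le hs.1 hx)
    rw [hs.2, nsmul_eq_mul] at h1
    have h2 : (1 : ℝ) ≤ k := by exact_mod_cast hk
    exact (le_mul_of_one_le_left hm.le h2).trans h1
  refine ⟨⟨hc, fun s h' => hm.trans_le (hs s h')⟩, ?_⟩
  have hcr : ((n.choose k : ℕ) : ℝ) ≠ 0 := by
    exact_mod_cast (Nat.choose_pos hkn).ne'
  have hp := pow_card_le_multiset_prod hm.le ((l.powersetCard k).map Multiset.sum) (by
    simp only [Multiset.mem_map]
    rintro _ ⟨t, ht, rfl⟩
    exact hs t ht)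
  rw [Multiset.card_map, Multiset.card_powersetCard, hc] at hp
  calc m = (m ^ n.choose k) ^ (1 / (n.choose k : ℝ)) := by
        rw [← Real.rpow_natCast, ← Real.rpow_mul hm.le, mul_one_div_cancel hcr, Real.rpow_one]
    _ ≤ piOp n k l := Real.rpow_le_rpow (by positivity) hp (by positivity)

end Multiset

/-! ### Eigenvalues of the derivative of the `p`-gradient. -/

section Eigenvalues

variable {n : ℕ}

/-- Having n real roots means that the characteristic polynomial splits. The derivative of
|Du|^(p-2)Du need not be symmetric, so this is what turns membership in a cone into information on
the trace. -/
theorem trace_eq_sum_pHessEigenvalues {p : ℝ} {u : E n → ℝ} {x : E n}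
    (h : Multiset.card (pHessEigenvalues p u x) = n) :
    LinearMap.trace ℝ (E n) (fderiv ℝ (pGrad p u) x : E n →ₗ[ℝ] E n)
      = (pHessEigenvalues p u x).sum := by
  refine Module.End.trace_eq_sum_roots_charpoly_of_splits ?_
  rw [Polynomial.splits_iff_card_roots, LinearMap.charpoly_natDegree]
  simpa [pHessEigenvalues] using h

theorem card_pHessEigenvalues_of_isSymmetric {p m : ℝ} {u : E n → ℝ} {x : E n}
    (hs : (fderiv ℝ (pGrad p u) x : E n →ₗ[ℝ] E n).IsSymmetric)
    (hm : ∀ v : E n, m * ‖v‖ ^ 2 ≤ inner ℝ (fderiv ℝ (pGrad p u) x v) v) :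
    Multiset.card (pHessEigenvalues p u x) = n ∧ ∀ y ∈ pHessEigenvalues p u x, m ≤ y := by
  have hn : Module.finrank ℝ (E n) = n := by simp
  have hr : pHessEigenvalues p u x = _ := hs.roots_charpoly_eq_eigenvalues hn
  rw [hr]
  refine ⟨by simp, ?_⟩
  simp only [Multiset.mem_map]
  rintro _ ⟨i, -, rfl⟩
  have h1 := hm (hs.eigenvectorBasis hn i)
  have h2 := hs.apply_eigenvectorBasis hn i
  have h3 : ‖hs.eigenvectorBasis hn i‖ = 1 := (hs.eigenvectorBasis hn).norm_eq_one i
  rw [ContinuousLinearMap.coe_coe] at h2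
  rw [h2, inner_smul_left, real_inner_self_eq_norm_sq, h3] at h1
  simpa using h1

end Eigenvalues

/-! ### Growth at a critical point where the `p`-Laplacian is positive. -/

open Filter Topology Set

variable {n : ℕ}

/-- The `p`-Laplacian `div (|Du|^{p-2} Du)`. -/
def pLaplacian (p : ℝ) (u : E n → ℝ) (x : E n) : ℝ :=
  LinearMap.trace ℝ (E n) (fderiv ℝ (pGrad p u) x : E n →ₗ[ℝ] E n)

theorem norm_rpow_smul {G : E n} (hG : G ≠ 0) (s : ℝ) : ‖‖G‖ ^ s • G‖ = ‖G‖ ^ (s + 1) := by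
  have h : 0 < ‖G‖ := norm_pos_iff.mpr hG
  rw [norm_smul, Real.norm_of_nonneg (by positivity), Real.rpow_add_one h.ne']

/-- G is recovered from V = |G|^(p-2)G as |G|^(2-p)V, where |G|^(2-p) = |V|^((2-p)/(p-1)). The sign
of that exponent depends on p, so both the lower and the upper bound on |V| are needed, hence the
`min`. -/
theorem le_inner_of_le_inner_rpow_smul {p δ K t : ℝ} {G e : E n} (hp : 1 < p) (ht : 0 < t)
    (hδ : 0 < δ) (hK : 0 < K) (he : ‖e‖ = 1) (h1 : δ * t ≤ inner ℝ (‖G‖ ^ (p - 2) • G) e)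
    (h2 : ‖‖G‖ ^ (p - 2) • G‖ ≤ K * t) :
    δ * min (δ ^ ((2 - p) / (p - 1))) (K ^ ((2 - p) / (p - 1))) * t ^ (1 / (p - 1))
      ≤ inner ℝ G e := by
  set σ := (2 - p) / (p - 1) with hσ
  have hp1 : p - 1 ≠ 0 := by linarith
  have hG : G ≠ 0 := by
    rintro rfl
    simp at h1
    nlinarith
  have hN : 0 < ‖G‖ := norm_pos_iff.mpr hG
  have hV : δ * t ≤ ‖‖G‖ ^ (p - 2) • G‖ :=
    h1.trans ((real_inner_le_norm _ _).trans (by rw [he, mul_one]))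
  rw [norm_rpow_smul hG] at h2 hV
  have hpow : ‖G‖ ^ (2 - p) = (‖G‖ ^ (p - 2 + 1)) ^ σ := by
    rw [← Real.rpow_mul hN.le]
    congr 1
    rw [hσ]
    field_simp
    ring
  have hmin : min (δ ^ σ) (K ^ σ) * t ^ σ ≤ ‖G‖ ^ (2 - p) := by
    rw [hpow]
    rcases le_total 0 σ with h | h
    · calc min (δ ^ σ) (K ^ σ) * t ^ σ ≤ δ ^ σ * t ^ σ := by
            gcongr; exact min_le_left _ _
        _ = (δ * t) ^ σ := (Real.mul_rpow hδ.le ht.le).symm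
        _ ≤ _ := Real.rpow_le_rpow (by positivity) hV h
    · calc min (δ ^ σ) (K ^ σ) * t ^ σ ≤ K ^ σ * t ^ σ := by
            gcongr; exact min_le_right _ _
        _ = (K * t) ^ σ := (Real.mul_rpow hK.le ht.le).symm
        _ ≤ _ := Real.rpow_le_rpow_of_nonpos (by positivity) h2 h
  have hinner : inner ℝ G e = ‖G‖ ^ (2 - p) * inner ℝ (‖G‖ ^ (p - 2) • G) e := by
    rw [real_inner_smul_left, ← mul_assoc, ← Real.rpow_add hN]
    simp
  rw [hinner]
  have ht1 : t ^ (1 / (p - 1)) = t ^ σ * t := by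
    rw [← Real.rpow_add_one ht.ne']
    congr 1
    rw [hσ]
    field_simp
    ring
  calc δ * min (δ ^ σ) (K ^ σ) * t ^ (1 / (p - 1))
      = (min (δ ^ σ) (K ^ σ) * t ^ σ) * (δ * t) := by rw [ht1]; ring
    _ ≤ _ := mul_le_mul hmin h1 (by positivity) (by positivity)

theorem hasDerivAt_line (x e : E n) (t : ℝ) : HasDerivAt (fun t : ℝ => x + t • e) e t := by
  simpa using ((hasDerivAt_id t).smul_const e).const_add x

theorem continuous_line (x e : E n) : Continuous fun t : ℝ => x + t • e := by fun_prop

theorem tendsto_line (x e : E n) : Tendsto (fun t : ℝ => x + t • e) (𝓝 0) (𝓝 x) := by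
  simpa using (continuous_line x e).tendsto 0

/-- A function with positive `p`-Laplacian at a critical point grows faster than any function
whose derivative vanishes there to a higher order than `1 / (p - 1)`. -/
theorem not_isLocalMax_sub_of_critical {p : ℝ} (hp : 1 < p) {u v : E n → ℝ} {x₀ : E n}
    (hu : Differentiable ℝ u) (hV : DifferentiableAt ℝ (pGrad p u) x₀)
    (h0 : gradient u x₀ = 0) (htr : 0 < pLaplacian p u x₀) {C m : ℝ}
    (hm : 1 / (p - 1) < m)
    (hv : ∀ᶠ x in 𝓝 x₀, DifferentiableAt ℝ v x ∧ ‖fderiv ℝ v x‖ ≤ C * ‖x - x₀‖ ^ m) :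
    ¬ IsLocalMax (fun x => u x - v x) x₀ := by
  intro hmax
  -- A positive trace has a positive diagonal entry, which selects the direction `e` along which u -
  -- v will increase.
  rw [pLaplacian, LinearMap.trace_eq_sum_inner _ (EuclideanSpace.basisFun (Fin n) ℝ)] at htr
  rw [← Finset.sum_const_zero (ι := Fin n) (s := Finset.univ)] at htr
  obtain ⟨i, -, hi⟩ := Finset.exists_lt_of_sum_lt htr
  set e : E n := EuclideanSpace.basisFun (Fin n) ℝ i with he
  have he1 : ‖e‖ = 1 := (EuclideanSpace.basisFun (Fin n) ℝ).norm_eq_one i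
  set B := fderiv ℝ (pGrad p u) x₀ with hB
  change 0 < inner ℝ e (B e) at hi
  set δ := inner ℝ e (B e) / 2 with hδ
  have hδ0 : 0 < δ := by positivity
  set K := ‖B e‖ + δ with hK
  have hK0 : 0 < K := by positivity
  have hV0 : pGrad p u x₀ = 0 := by simp [pGrad, h0]
  have hd : HasDerivAt (fun t : ℝ => pGrad p u (x₀ + t • e)) (B e) 0 := by
    have h1 : HasFDerivAt (pGrad p u) B (x₀ + (0 : ℝ) • e) := by simpa using hV.hasFDerivAt
    exact h1.comp_hasDerivAt 0 (hasDerivAt_line x₀ e 0)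
  have hlo := (hasDerivAt_iff_isLittleO.mp hd).def hδ0
  simp only [zero_smul, add_zero, hV0, sub_zero] at hlo
  have hline := tendsto_line x₀ e
  set σ := (2 - p) / (p - 1) with hσ
  set c := δ * min (δ ^ σ) (K ^ σ) with hc
  have hc0 : 0 < c := by positivity
  have hpow : Tendsto (fun t : ℝ => C * t ^ (m - 1 / (p - 1))) (𝓝 0) (𝓝 0) := by
    have h2 : 0 < m - 1 / (p - 1) := by linarith
    have := ((Real.continuousAt_rpow_const 0 _ (Or.inr h2.le)).tendsto).const_mul C
    rwa [Real.zero_rpow h2.ne', mul_zero] at this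
  have hev : ∀ᶠ t in 𝓝 (0 : ℝ), ‖pGrad p u (x₀ + t • e) - t • B e‖ ≤ δ * ‖t‖ ∧
      (DifferentiableAt ℝ v (x₀ + t • e) ∧
        ‖fderiv ℝ v (x₀ + t • e)‖ ≤ C * ‖x₀ + t • e - x₀‖ ^ m) ∧
      u (x₀ + t • e) - v (x₀ + t • e) ≤ u x₀ - v x₀ ∧ C * t ^ (m - 1 / (p - 1)) < c :=
    hlo.and ((hline.eventually hv).and ((hline.eventually hmax).and (hpow.eventually_lt_const hc0)))
  obtain ⟨ε, hε, hball⟩ := Metric.eventually_nhds_iff.mp hev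
  have hderiv : ∀ t ∈ Ico (0 : ℝ) ε, HasDerivAt (fun t : ℝ => u (x₀ + t • e) - v (x₀ + t • e))
      (inner ℝ (gradient u (x₀ + t • e)) e - fderiv ℝ v (x₀ + t • e) e) t := by
    intro t ht
    have hb := hball (y := t) (by rw [Real.dist_eq, sub_zero, abs_of_nonneg ht.1]; exact ht.2)
    rw [inner_gradient_left]
    exact ((hu _).hasFDerivAt.comp_hasDerivAt t (hasDerivAt_line x₀ e t)).sub
      (hb.2.1.1.hasFDerivAt.comp_hasDerivAt t (hasDerivAt_line x₀ e t))
  -- The slope of u along `e` is at least c t^(1/(p-1)), that of v at most C t^m with m > 1/(p-1).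
  have hmono : StrictMonoOn (fun t : ℝ => u (x₀ + t • e) - v (x₀ + t • e)) (Icc 0 (ε / 2)) := by
    refine strictMonoOn_of_deriv_pos (convex_Icc _ _) (fun t ht =>
      (hderiv t ⟨ht.1, by linarith [ht.2]⟩).continuousAt.continuousWithinAt) fun t ht => ?_
    rw [interior_Icc] at ht
    have ht0 : 0 < t := ht.1
    rw [(hderiv t ⟨ht0.le, by linarith [ht.2]⟩).deriv, sub_pos]
    obtain ⟨hb1, ⟨-, hb2⟩, -, hb4⟩ := hball (y := t)
      (by rw [Real.dist_eq, sub_zero, abs_of_pos ht0]; linarith [ht.2])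
    rw [Real.norm_of_nonneg ht0.le] at hb1
    rw [add_sub_cancel_left, norm_smul, he1, mul_one, Real.norm_of_nonneg ht0.le] at hb2
    have h1 : δ * t ≤ inner ℝ (pGrad p u (x₀ + t • e)) e := by
      have h3 : inner ℝ (pGrad p u (x₀ + t • e)) e
          = inner ℝ (pGrad p u (x₀ + t • e) - t • B e) e + t * (2 * δ) := by
        rw [inner_sub_left, real_inner_smul_left, real_inner_comm, hδ, real_inner_comm e (B e)]
        ring
      have h4 := abs_real_inner_le_norm (pGrad p u (x₀ + t • e) - t • B e) e
      rw [he1, mul_one] at h4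
      have h5 := neg_abs_le (inner ℝ (pGrad p u (x₀ + t • e) - t • B e) e)
      nlinarith
    have h2 : ‖pGrad p u (x₀ + t • e)‖ ≤ K * t := by
      have h3 := norm_add_le (pGrad p u (x₀ + t • e) - t • B e) (t • B e)
      rw [sub_add_cancel, norm_smul, Real.norm_of_nonneg ht0.le] at h3
      rw [hK]
      nlinarith
    have h3 := le_inner_of_le_inner_rpow_smul hp ht0 hδ0 hK0 he1 h1 h2
    calc fderiv ℝ v (x₀ + t • e) e ≤ ‖fderiv ℝ v (x₀ + t • e) e‖ := le_abs_self _
      _ ≤ ‖fderiv ℝ v (x₀ + t • e)‖ := by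
          simpa [he1] using (fderiv ℝ v (x₀ + t • e)).le_opNorm e
      _ ≤ C * t ^ m := hb2
      _ = C * t ^ (m - 1 / (p - 1)) * t ^ (1 / (p - 1)) := by
          rw [mul_assoc, ← Real.rpow_add ht0, sub_add_cancel]
      _ < c * t ^ (1 / (p - 1)) := by gcongr
      _ ≤ _ := h3
  have hlt := hmono (left_mem_Icc.mpr (by positivity)) (right_mem_Icc.mpr (by positivity))
    (half_pos hε)
  have hle := (hball (y := ε / 2) (by
    rw [Real.dist_eq, sub_zero, abs_of_pos (half_pos hε)]; linarith)).2.2.1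
  simp only [zero_smul, add_zero] at hlt
  linarith

/-! ### Second-order comparison with radial functions touching from above. -/

/-- If f'' > 0, the point is also a local minimum, so f is locally constant and f'' = 0. -/
theorem second_deriv_nonpos_of_isLocalMax {f f' : ℝ → ℝ} {f'' x₀ : ℝ} (hmax : IsLocalMax f x₀)
    (hf : ∀ᶠ t in 𝓝 x₀, HasDerivAt f (f' t) t) (hf' : HasDerivAt f' f'' x₀) : f'' ≤ 0 := by
  by_contra! hpos
  have hd : deriv f =ᶠ[𝓝 x₀] f' := hf.mono fun t ht => ht.deriv
  have hdd : deriv (deriv f) x₀ = f'' := by rw [hd.deriv_eq, hf'.deriv]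
  have hmin := isLocalMin_of_deriv_deriv_pos (hdd ▸ hpos) hmax.deriv_eq_zero
    hf.self_of_nhds.continuousAt
  have hconst : f =ᶠ[𝓝 x₀] fun _ => f x₀ := by
    filter_upwards [hmax, hmin] with t h1 h2 using le_antisymm h1 h2
  have h3 : deriv f =ᶠ[𝓝 x₀] fun _ => 0 := hconst.deriv.trans (by simp)
  rw [h3.deriv_eq] at hdd
  simp at hdd
  linarith

theorem hasFDerivAt_norm_rpow_of_ne {x : E n} (hx : x ≠ 0) (s : ℝ) :
    HasFDerivAt (fun x : E n => ‖x‖ ^ s) ((s * ‖x‖ ^ (s - 2)) • innerSL ℝ x) x := by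
  apply HasStrictFDerivAt.hasFDerivAt
  convert! (hasStrictFDerivAt_norm_sq x).rpow_const (p := s / 2) (by simp [hx]) using 0
  simp_rw [← Real.rpow_natCast_mul (norm_nonneg _), ← Nat.cast_smul_eq_nsmul ℝ, smul_smul]
  ring_nf

theorem hasFDerivAt_pGrad {p : ℝ} {u : E n → ℝ} {x : E n} {H : E n →L[ℝ] E n}
    (hH : HasFDerivAt (gradient u) H x) (h0 : gradient u x ≠ 0) :
    HasFDerivAt (pGrad p u) (‖gradient u x‖ ^ (p - 2) • H +
      (((p - 2) * ‖gradient u x‖ ^ (p - 2 - 2)) •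
        (innerSL ℝ (gradient u x)).comp H).smulRight (gradient u x)) x := by
  have h := ((hasFDerivAt_norm_rpow_of_ne h0 (p - 2)).comp x hH).smul hH
  exact h

/-- An orthonormal basis whose first vector is a given unit vector. -/
theorem exists_orthonormalBasis_apply_eq (i₀ : Fin n) {ν : E n} (hν : ‖ν‖ = 1) :
    ∃ b : OrthonormalBasis (Fin n) ℝ (E n), b i₀ = ν := by
  obtain ⟨b, hb⟩ := Orthonormal.exists_orthonormalBasis_extension_of_card_eq (𝕜 := ℝ)
    (E := E n) (ι := Fin n) (by simp) (v := fun _ => ν) (s := {i₀}) (by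
      rw [orthonormal_iff_ite]
      rintro ⟨i, rfl⟩ ⟨j, hj⟩
      obtain rfl : j = i := hj
      simp [Set.domRestrict, hν])
  exact ⟨b, hb i₀ rfl⟩

/-- Differentiating |Du|^(p-2) gives a rank-one term with range along Du, so in a basis containing
that direction ν it contributes only (p-2)u_νν to the trace. -/
theorem pLaplacian_eq_sum {p : ℝ} {u : E n → ℝ} {x : E n} {H : E n →L[ℝ] E n}
    (hH : HasFDerivAt (gradient u) H x) (h0 : gradient u x ≠ 0)
    (b : OrthonormalBasis (Fin n) ℝ (E n)) {i₀ : Fin n} {τ : ℝ} (hb : gradient u x = τ • b i₀) :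
    pLaplacian p u x = ‖gradient u x‖ ^ (p - 2) *
      ((p - 2) * inner ℝ (b i₀) (H (b i₀)) + ∑ i, inner ℝ (b i) (H (b i))) := by
  have hτ : ‖gradient u x‖ ^ 2 = τ ^ 2 := by
    rw [hb, norm_smul, b.norm_eq_one, mul_one, Real.norm_eq_abs, sq_abs]
  have hN : 0 < ‖gradient u x‖ := norm_pos_iff.mpr h0
  rw [pLaplacian, LinearMap.trace_eq_sum_inner _ b, (hasFDerivAt_pGrad hH h0).fderiv]
  have hterm : ∀ i, inner ℝ (b i) ((‖gradient u x‖ ^ (p - 2) • H +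
      (((p - 2) * ‖gradient u x‖ ^ (p - 2 - 2)) •
        (innerSL ℝ (gradient u x)).comp H).smulRight (gradient u x)) (b i))
      = ‖gradient u x‖ ^ (p - 2) * inner ℝ (b i) (H (b i)) +
        if i = i₀ then ‖gradient u x‖ ^ (p - 2) * (p - 2) * inner ℝ (b i₀) (H (b i₀)) else 0 := by
    intro i
    simp only [add_apply, smul_apply,
      ContinuousLinearMap.smulRight_apply, ContinuousLinearMap.comp_apply, innerSL_apply_apply,
      inner_add_right, real_inner_smul_right, smul_eq_mul]
    congr 1
    have h1 : ‖gradient u x‖ ^ (p - 2) = ‖gradient u x‖ ^ (p - 2 - 2) * τ ^ 2 := by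
      rw [← hτ, ← Real.rpow_natCast, ← Real.rpow_add hN]
      norm_num
    split_ifs with h
    · subst h
      rw [h1]
      nth_rw 2 [hb]
      nth_rw 2 [hb]
      rw [real_inner_smul_left, real_inner_smul_right, real_inner_self_eq_norm_sq, b.norm_eq_one]
      ring
    · nth_rw 3 [hb]
      rw [real_inner_smul_right, b.inner_eq_zero h]
      ring
  simp only [ContinuousLinearMap.coe_coe, hterm, Finset.sum_add_distrib, Finset.sum_ite_eq',
    Finset.mem_univ, if_true, ← Finset.mul_sum]
  ring

theorem hasFDerivAt_comp_norm_sq {Φ : ℝ → ℝ} {Φ' : ℝ} {x : E n}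
    (h : HasDerivAt Φ Φ' (‖x‖ ^ 2)) :
    HasFDerivAt (fun x : E n => Φ (‖x‖ ^ 2)) (Φ' • (2 : ℝ) • innerSL ℝ x) x := by
  have h1 := (hasStrictFDerivAt_norm_sq x).hasFDerivAt
  have h2 := h.comp_hasFDerivAt x h1
  rwa [← Nat.cast_smul_eq_nsmul ℝ] at h2

/-- Comparison of second derivatives at a point where `u` is touched from above by a radial
function `Φ (|x|²)`. -/
theorem pLaplacian_le_of_touching {p : ℝ} (hp : 1 < p) {u : E n → ℝ} {x₀ : E n} (hx₀ : x₀ ≠ 0)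
    (hu : ContDiffAt ℝ 2 u x₀) {Φ Φ' : ℝ → ℝ} {Φ'' : ℝ}
    (hΦ : ∀ᶠ ρ in 𝓝 (‖x₀‖ ^ 2), HasDerivAt Φ (Φ' ρ) ρ) (hΦ' : HasDerivAt Φ' Φ'' (‖x₀‖ ^ 2))
    (hne : Φ' (‖x₀‖ ^ 2) ≠ 0) (hmax : IsLocalMax (fun x => u x - Φ (‖x‖ ^ 2)) x₀) :
    gradient u x₀ = (2 * Φ' (‖x₀‖ ^ 2)) • x₀ ∧
    pLaplacian p u x₀ ≤ ‖gradient u x₀‖ ^ (p - 2) *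
      ((p - 1) * (2 * Φ' (‖x₀‖ ^ 2) + 4 * ‖x₀‖ ^ 2 * Φ'')
        + (n - 1) * (2 * Φ' (‖x₀‖ ^ 2))) := by
  have hud : DifferentiableAt ℝ u x₀ := hu.differentiableAt (by norm_num)
  have hgrad : gradient u x₀ = (2 * Φ' (‖x₀‖ ^ 2)) • x₀ := by
    have h1 := hmax.hasFDerivAt_eq_zero
      (hud.hasFDerivAt.sub (hasFDerivAt_comp_norm_sq hΦ.self_of_nhds))
    refine ext_inner_right ℝ fun w => ?_
    have h2 := congrArg (fun L => L w) h1
    simp only [sub_apply, smul_apply, innerSL_apply_apply,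
      zero_apply, smul_eq_mul] at h2
    rw [inner_gradient_left, real_inner_smul_left]
    linarith
  have hg0 : gradient u x₀ ≠ 0 := by
    rw [hgrad]
    exact smul_ne_zero (mul_ne_zero two_ne_zero hne) hx₀
  have hgd : DifferentiableAt ℝ (gradient u) x₀ := by
    have h1 : DifferentiableAt ℝ (fderiv ℝ u) x₀ :=
      (hu.fderiv_right (m := 1) (by norm_num)).differentiableAt (by norm_num)
    exact (InnerProductSpace.toDual ℝ (E n)).symm.differentiable.differentiableAt.comp x₀ h1
  set H := fderiv ℝ (gradient u) x₀ with hH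
  have hev : ∀ᶠ x in 𝓝 x₀, DifferentiableAt ℝ u x :=
    (hu.eventually (by simp)).mono fun x hx => hx.differentiableAt (by norm_num)
  -- Second derivative test for u - Φ(|x|²) restricted to the line through x₀ in direction `e`.
  have hquad : ∀ e : E n, inner ℝ e (H e)
      ≤ 4 * Φ'' * (inner ℝ x₀ e) ^ 2 + 2 * Φ' (‖x₀‖ ^ 2) * ‖e‖ ^ 2 := by
    intro e
    have hline := tendsto_line x₀ e
    have hnorm : Tendsto (fun t : ℝ => ‖x₀ + t • e‖ ^ 2) (𝓝 0) (𝓝 (‖x₀‖ ^ 2)) :=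
      (hline.norm).pow 2
    have hnd : ∀ t : ℝ, HasDerivAt (fun t : ℝ => ‖x₀ + t • e‖ ^ 2)
        (2 * inner ℝ (x₀ + t • e) e) t := fun t => (hasDerivAt_line x₀ e t).norm_sq
    have hmax1 : IsLocalMax (fun t : ℝ => u (x₀ + t • e) - Φ (‖x₀ + t • e‖ ^ 2)) 0 := by
      filter_upwards [hline.eventually hmax] with t ht
      simpa using ht
    have hd1 : ∀ᶠ t in 𝓝 (0 : ℝ), HasDerivAt (fun t : ℝ => u (x₀ + t • e) - Φ (‖x₀ + t • e‖ ^ 2))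
        (inner ℝ (gradient u (x₀ + t • e)) e
          - Φ' (‖x₀ + t • e‖ ^ 2) * (2 * inner ℝ (x₀ + t • e) e)) t := by
      filter_upwards [hline.eventually hev, hnorm.eventually hΦ] with t h1 h2
      rw [inner_gradient_left]
      exact (h1.hasFDerivAt.comp_hasDerivAt t (hasDerivAt_line x₀ e t)).sub (h2.comp t (hnd t))
    have hd2 : HasDerivAt (fun t : ℝ => inner ℝ (gradient u (x₀ + t • e)) e
          - Φ' (‖x₀ + t • e‖ ^ 2) * (2 * inner ℝ (x₀ + t • e) e))
        (inner ℝ (H e) e - (Φ'' * (2 * inner ℝ x₀ e) * (2 * inner ℝ x₀ e)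
          + Φ' (‖x₀‖ ^ 2) * (2 * inner ℝ e e))) 0 := by
      have e1 : x₀ + (0 : ℝ) • e = x₀ := by simp
      have a1 : HasDerivAt (fun t : ℝ => gradient u (x₀ + t • e)) (H e) 0 := by
        have h1 : HasFDerivAt (gradient u) H (x₀ + (0 : ℝ) • e) := by
          rw [e1]; exact hgd.hasFDerivAt
        exact h1.comp_hasDerivAt 0 (hasDerivAt_line x₀ e 0)
      have a2 : HasDerivAt (fun t : ℝ => inner ℝ (gradient u (x₀ + t • e)) e)
          (inner ℝ (H e) e) 0 := by
        simpa using a1.inner ℝ (hasDerivAt_const (0 : ℝ) e)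
      have a3 : HasDerivAt (fun t : ℝ => inner ℝ (x₀ + t • e) e) (inner ℝ e e) 0 := by
        simpa using (hasDerivAt_line x₀ e 0).inner ℝ (hasDerivAt_const (0 : ℝ) e)
      have a4 : HasDerivAt (fun t : ℝ => Φ' (‖x₀ + t • e‖ ^ 2))
          (Φ'' * (2 * inner ℝ x₀ e)) 0 := by
        have h1 : HasDerivAt Φ' Φ'' (‖x₀ + (0 : ℝ) • e‖ ^ 2) := by rw [e1]; exact hΦ'
        have h2 := h1.comp (0 : ℝ) (hnd 0)
        rw [e1] at h2
        exact h2
      have a5 := a2.sub (a4.mul (a3.const_mul 2))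
      rw [e1] at a5
      exact a5
    have h := second_deriv_nonpos_of_isLocalMax hmax1 hd1 hd2
    rw [real_inner_comm, real_inner_self_eq_norm_sq] at h
    linarith
  refine ⟨hgrad, ?_⟩
  have hr : 0 < ‖x₀‖ := norm_pos_iff.mpr hx₀
  obtain ⟨i₀⟩ : Nonempty (Fin n) := by
    by_contra hcon
    rw [not_nonempty_iff] at hcon
    exact hx₀ (Subsingleton.elim _ _)
  have hν : ‖(‖x₀‖⁻¹ • x₀)‖ = 1 := by
    rw [norm_smul, norm_inv, norm_norm, inv_mul_cancel₀ hr.ne']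
  -- In a basis adapted to x₀ the radial direction gets weight (p-2) + 1 = p - 1 and sees Φ''; the
  -- other n - 1 directions see only Φ'.
  obtain ⟨b, hb⟩ := exists_orthonormalBasis_apply_eq i₀ hν
  have hxb : x₀ = ‖x₀‖ • b i₀ := by
    rw [hb, smul_smul, mul_inv_cancel₀ hr.ne', one_smul]
  have hgb : gradient u x₀ = (2 * Φ' (‖x₀‖ ^ 2) * ‖x₀‖) • b i₀ := by
    rw [hgrad, mul_smul _ ‖x₀‖, ← hxb]
  rw [pLaplacian_eq_sum hgd.hasFDerivAt hg0 b hgb]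
  refine mul_le_mul_of_nonneg_left ?_ (by positivity)
  have hi0 : inner ℝ x₀ (b i₀) = ‖x₀‖ := by
    nth_rw 1 [hxb]
    rw [real_inner_smul_left, real_inner_self_eq_norm_sq, b.norm_eq_one]
    ring
  have h1 := hquad (b i₀)
  rw [hi0, b.norm_eq_one] at h1
  have h2 : ∑ i ∈ Finset.univ.erase i₀, inner ℝ (b i) (H (b i))
      ≤ ∑ i ∈ Finset.univ.erase i₀, 2 * Φ' (‖x₀‖ ^ 2) := by
    refine Finset.sum_le_sum fun i hi => ?_
    have h3 := hquad (b i)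
    have h4 : inner ℝ x₀ (b i) = 0 := by
      rw [hxb, real_inner_smul_left, b.inner_eq_zero (Finset.ne_of_mem_erase hi).symm, mul_zero]
    rw [h4, b.norm_eq_one] at h3
    linarith
  rw [← Finset.add_sum_erase _ _ (Finset.mem_univ i₀)]
  rw [Finset.sum_const, Finset.card_erase_of_mem (Finset.mem_univ i₀), Finset.card_univ,
    Fintype.card_fin, nsmul_eq_mul, Nat.cast_sub (by have := i₀.isLt; omega), Nat.cast_one] at h2
  nlinarith

/-! ### Maximum principle, including the origin. -/

/-- Strict `p`-subharmonicity away from the origin, in the classical sense. -/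
structure IsPSubharmonicOffZero (p : ℝ) (u : E n → ℝ) : Prop where
  contDiff_one : ContDiff ℝ 1 u
  contDiffOn_two : ContDiffOn ℝ 2 u {0}ᶜ
  differentiableAt_pGrad : ∀ x : E n, x ≠ 0 → DifferentiableAt ℝ (pGrad p u) x
  pLaplacian_pos : ∀ x : E n, x ≠ 0 → 0 < pLaplacian p u x

namespace IsPSubharmonicOffZero

variable {p : ℝ} {u : E n → ℝ}

theorem contDiffAt_two (h : IsPSubharmonicOffZero p u) {x : E n} (hx : x ≠ 0) :
    ContDiffAt ℝ 2 u x :=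
  (h.contDiffOn_two x hx).contDiffAt (isOpen_compl_singleton.mem_nhds hx)

theorem differentiable (h : IsPSubharmonicOffZero p u) : Differentiable ℝ u :=
  h.contDiff_one.differentiable (by norm_num)

theorem not_isLocalMax_of_ne_zero (h : IsPSubharmonicOffZero p u) (hp : 1 < p) {x : E n}
    (hx : x ≠ 0) : ¬ IsLocalMax u x := by
  intro hmax
  have h0 : gradient u x = 0 := by simp [gradient, hmax.fderiv_eq_zero]
  refine not_isLocalMax_sub_of_critical hp (v := fun _ => 0) (C := 0) (m := 1 / (p - 1) + 1)
    h.differentiable (h.differentiableAt_pGrad x hx) h0 (h.pLaplacian_pos x hx) (by linarith)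
    ?_ (by simpa using hmax)
  filter_upwards with y
  simp

/-- The function -a|x| has zero second radial derivative and nonpositive tangential ones, so its
`p`-Laplacian is nonpositive and it cannot touch u from above. -/
theorem not_touching_cone (h : IsPSubharmonicOffZero p u) (hp : 1 < p) {x : E n}
    (hx : x ≠ 0) {a : ℝ} (ha : 0 < a) : ¬ IsLocalMax (fun x => u x + a * ‖x‖) x := by
  intro hmax
  have hr : 0 < ‖x‖ := norm_pos_iff.mpr hx
  have hn : 1 ≤ n := by
    by_contra! hn
    obtain rfl : n = 0 := by omega
    exact hx (Subsingleton.elim _ _)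
  have hρ : 0 < ‖x‖ ^ 2 := by positivity
  have hsqrt : √(‖x‖ ^ 2) = ‖x‖ := Real.sqrt_sq hr.le
  have hΦ : ∀ᶠ ρ in 𝓝 (‖x‖ ^ 2),
      HasDerivAt (fun ρ : ℝ => -a * √ρ) (-a * (1 / (2 * √ρ))) ρ := by
    filter_upwards [lt_mem_nhds hρ] with ρ hρ'
    exact (Real.hasDerivAt_sqrt hρ'.ne').const_mul _
  have hΦ' : HasDerivAt (fun ρ : ℝ => -a * (1 / (2 * √ρ))) (a / (4 * ‖x‖ ^ 3)) (‖x‖ ^ 2) := by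
    have h1 := (((Real.hasDerivAt_sqrt hρ.ne').const_mul 2).inv
      (by rw [hsqrt]; positivity)).const_mul (-a)
    rw [hsqrt] at h1
    refine (h1.congr_deriv ?_).congr_of_eventuallyEq ?_
    · field_simp; norm_num
    · filter_upwards with ρ
      rw [one_div]
      rfl
  have hne : -a * (1 / (2 * √(‖x‖ ^ 2))) ≠ 0 := by
    rw [hsqrt]
    have : 0 < a * (1 / (2 * ‖x‖)) := by positivity
    linarith
  obtain ⟨-, h2⟩ := pLaplacian_le_of_touching hp hx (h.contDiffAt_two hx) hΦ hΦ' hne (by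
    refine hmax.congr ?_
    filter_upwards with y
    rw [Real.sqrt_sq (norm_nonneg y)]
    ring)
  have h3 := h.pLaplacian_pos x hx
  rw [hsqrt] at h2
  have h4 : 2 * (-a * (1 / (2 * ‖x‖))) + 4 * ‖x‖ ^ 2 * (a / (4 * ‖x‖ ^ 3)) = 0 := by
    field_simp; ring
  rw [h4, mul_zero, zero_add] at h2
  have h5 : ((n : ℝ) - 1) * (2 * (-a * (1 / (2 * ‖x‖)))) ≤ 0 := by
    refine mul_nonpos_of_nonneg_of_nonpos ?_ ?_
    · have : (1 : ℝ) ≤ n := by exact_mod_cast hn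
      linarith
    · have : 0 < a * (1 / (2 * ‖x‖)) := by positivity
      linarith
  have h6 := mul_nonpos_of_nonneg_of_nonpos
    (Real.rpow_nonneg (norm_nonneg (gradient u x)) (p - 2)) h5
  linarith

/-- The equation gives nothing at 0. A local maximum there would be strict on a small sphere;
comparison with a cone of vertex (0, u(0)) then forces a negative one-sided slope at 0, against
differentiability of u with vanishing gradient. -/
theorem not_isLocalMax (h : IsPSubharmonicOffZero p u) (hp : 1 < p) (hn : 0 < n) (x : E n) :
    ¬ IsLocalMax u x := by
  rcases ne_or_eq x 0 with hx | rfl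
  · exact h.not_isLocalMax_of_ne_zero hp hx
  intro hmax
  have hcont : Continuous u := h.differentiable.continuous
  obtain ⟨ρ, hρ, hball⟩ := Metric.eventually_nhds_iff.mp hmax
  set r := ρ / 2 with hr
  have hr0 : 0 < r := by positivity
  have hlt : ∀ x ∈ Metric.sphere (0 : E n) r, u x < u 0 := by
    intro x hx
    rw [mem_sphere_zero_iff_norm] at hx
    have hx0 : x ≠ 0 := by rw [← norm_pos_iff, hx]; exact hr0
    refine lt_of_le_of_ne (hball (by rw [dist_zero_right]; linarith)) fun heq => ?_
    refine h.not_isLocalMax_of_ne_zero hp hx0 ?_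
    have hmem : Metric.ball (0 : E n) ρ ∈ 𝓝 x :=
      Metric.isOpen_ball.mem_nhds (by rw [mem_ball_zero_iff]; linarith)
    filter_upwards [hmem] with y hy
    rw [heq]
    exact hball hy
  obtain ⟨η, hη, hsph⟩ : ∃ η > 0, ∀ x ∈ Metric.sphere (0 : E n) r, u x ≤ u 0 - η := by
    rcases (Metric.sphere (0 : E n) r).eq_empty_or_nonempty with he | hne
    · exact ⟨1, one_pos, fun x hx => by simp [he] at hx⟩
    · obtain ⟨y, hy, hymax⟩ := (isCompact_sphere (0 : E n) r).exists_isMaxOn hne hcont.continuousOn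
      exact ⟨u 0 - u y, sub_pos.mpr (hlt y hy), fun x hx => by
        have := hymax hx
        simp only [mem_ofPred_eq] at this
        linarith⟩
  set a := η / r with ha
  have ha0 : 0 < a := by positivity
  -- The slope a = η/r makes the inequality hold on the sphere; a larger interior value would be a
  -- touching point off the origin.
  have hcone : ∀ x ∈ Metric.closedBall (0 : E n) r, u x + a * ‖x‖ ≤ u 0 := by
    obtain ⟨y, hy, hymax⟩ := (isCompact_closedBall (0 : E n) r).exists_isMaxOn
      ⟨0, Metric.mem_closedBall_self hr0.le⟩
      (f := fun x => u x + a * ‖x‖) (by fun_prop)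
    intro x hx
    refine (hymax hx).trans ?_
    by_contra! hgt
    have hy0 : y ≠ 0 := by
      rintro rfl
      simp at hgt
    rw [mem_closedBall_zero_iff] at hy
    rcases hy.eq_or_lt with heq | hlt'
    · have := hsph y (by rwa [mem_sphere_zero_iff_norm])
      rw [heq, ha, div_mul_cancel₀ _ hr0.ne'] at hgt
      linarith
    · refine h.not_touching_cone hp hy0 ha0 ?_
      filter_upwards [Metric.isOpen_ball.mem_nhds (mem_ball_zero_iff.mpr hlt')] with z hz
      exact hymax (Metric.ball_subset_closedBall hz)
  set e : E n := EuclideanSpace.single ⟨0, hn⟩ 1 with he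
  have he1 : ‖e‖ = 1 := by simp [he]
  have hd : HasDerivAt (fun t : ℝ => u ((0 : E n) + t • e)) 0 0 := by
    have h1 : HasFDerivAt u (0 : E n →L[ℝ] ℝ) ((0 : E n) + (0 : ℝ) • e) := by
      rw [zero_smul, add_zero, ← hmax.fderiv_eq_zero]
      exact (h.differentiable 0).hasFDerivAt
    exact h1.comp_hasDerivAt 0 (hasDerivAt_line 0 e 0)
  have hslope := (hasDerivWithinAt_iff_tendsto_slope' (by simp)).mp
    (hd.hasDerivWithinAt (s := Ioi 0))
  have hle : (0 : ℝ) ≤ -a := by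
    refine le_of_tendsto hslope ?_
    filter_upwards [Ioo_mem_nhdsGT hr0] with t ht
    have h1 := hcone (0 + t • e) (by
      rw [zero_add, mem_closedBall_zero_iff, norm_smul, he1, mul_one, Real.norm_of_nonneg ht.1.le]
      exact ht.2.le)
    rw [zero_add, norm_smul, he1, mul_one, Real.norm_of_nonneg ht.1.le] at h1
    simp only [slope_def_field, zero_add, zero_smul, sub_zero]
    rw [div_le_iff₀ ht.1]
    linarith
  linarith

end IsPSubharmonicOffZero

/-! ### The blow-up barrier and its supersolution inequality. -/

theorem hasDerivAt_max_zero_pow {m : ℕ} (hm : 2 ≤ m) (t : ℝ) :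
    HasDerivAt (fun t : ℝ => (max t 0) ^ m) (m * (max t 0) ^ (m - 1)) t := by
  rcases lt_trichotomy t 0 with h | rfl | h
  · have h1 : (fun t : ℝ => (max t 0) ^ m) =ᶠ[𝓝 t] fun _ => 0 := by
      filter_upwards [gt_mem_nhds h] with s hs
      rw [max_eq_right hs.le, zero_pow (by omega)]
    rw [max_eq_right h.le, zero_pow (by omega), mul_zero]
    exact (hasDerivAt_const t (0 : ℝ)).congr_of_eventuallyEq h1
  · rw [max_self, zero_pow (by omega), mul_zero, ← hasDerivWithinAt_univ, ← Iic_union_Ici (a := 0)]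
    refine HasDerivWithinAt.union ?_ ?_
    · refine (hasDerivWithinAt_const (0 : ℝ) (Iic 0) (0 : ℝ)).congr (fun s hs => ?_) ?_
      · rw [max_eq_right hs, zero_pow (by omega)]
      · rw [max_self, zero_pow (by omega)]
    · have h1 := (hasDerivAt_pow m (0 : ℝ)).hasDerivWithinAt (s := Ici 0)
      rw [zero_pow (by omega), mul_zero] at h1
      refine h1.congr (fun s hs => ?_) ?_
      · rw [max_eq_left hs]
      · rw [max_self]
  · have h1 : (fun t : ℝ => (max t 0) ^ m) =ᶠ[𝓝 t] fun t => t ^ m := by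
      filter_upwards [lt_mem_nhds h] with s hs
      rw [max_eq_left hs.le]
    rw [max_eq_left h.le]
    exact (hasDerivAt_pow m t).congr_of_eventuallyEq h1

/-- The profile `z(ρ)`, increasing from `0` at `ρ = A / 4` to `∞` at `ρ = A`. -/
def barrierVar (A ρ : ℝ) : ℝ := (ρ - A / 4) / (A - ρ)

/-- The derivative of `barrierVar`, expressed through its value. -/
theorem hasDerivAt_barrierVar {A ρ : ℝ} (hA : 0 < A) (hρ : ρ < A) :
    HasDerivAt (barrierVar A) (4 / (3 * A) * (barrierVar A ρ + 1) ^ 2) ρ := by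
  have h0 : A - ρ ≠ 0 := by linarith
  have h1 := ((hasDerivAt_id ρ).sub_const (A / 4)).div ((hasDerivAt_id ρ).const_sub A) h0
  refine h1.congr_deriv ?_
  simp only [barrierVar, id]
  field_simp
  ring

/-- The radial barrier as a function of `ρ = |x|²`; constant for `ρ ≤ A / 4`, infinite at `A`. -/
def barrier (A lam : ℝ) (m : ℕ) (ρ : ℝ) : ℝ := lam * (1 + (max (barrierVar A ρ) 0) ^ m)

/-- The derivative of `barrier`. -/
def barrierDeriv (A lam : ℝ) (m : ℕ) (ρ : ℝ) : ℝ :=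
  lam * (m * (max (barrierVar A ρ) 0) ^ (m - 1) * (4 / (3 * A) * (barrierVar A ρ + 1) ^ 2))

theorem hasDerivAt_barrier {A lam ρ : ℝ} {m : ℕ} (hm : 2 ≤ m) (hA : 0 < A) (hρ : ρ < A) :
    HasDerivAt (barrier A lam m) (barrierDeriv A lam m ρ) ρ :=
  (((hasDerivAt_max_zero_pow hm _).comp ρ (hasDerivAt_barrierVar hA hρ)).const_add 1).const_mul lam

theorem barrierVar_pos {A ρ : ℝ} (hρ : ρ < A) (h : A / 4 < ρ) : 0 < barrierVar A ρ :=
  div_pos (by linarith) (by linarith)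

theorem barrierVar_nonpos {A ρ : ℝ} (hρ : ρ < A) (h : ρ ≤ A / 4) : barrierVar A ρ ≤ 0 :=
  div_nonpos_of_nonpos_of_nonneg (by linarith) (by linarith)

theorem barrier_of_le {A lam ρ : ℝ} {m : ℕ} (hm : 2 ≤ m) (hρ : ρ < A) (h : ρ ≤ A / 4) :
    barrier A lam m ρ = lam := by
  rw [barrier, max_eq_right (barrierVar_nonpos hρ h), zero_pow (by omega)]
  ring

theorem barrierDeriv_of_le {A lam ρ : ℝ} {m : ℕ} (hm : 2 ≤ m) (hρ : ρ < A) (h : ρ ≤ A / 4) :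
    barrierDeriv A lam m ρ = 0 := by
  rw [barrierDeriv, max_eq_right (barrierVar_nonpos hρ h), zero_pow (by omega)]
  ring

theorem amplitude_le_barrier {A lam ρ : ℝ} {m : ℕ} (hlam : 0 ≤ lam) : lam ≤ barrier A lam m ρ := by
  unfold barrier
  exact le_mul_of_one_le_right hlam (by linarith [pow_nonneg (le_max_right (barrierVar A ρ) 0) m])

/-- The second derivative of `barrier` where it is not constant. -/
def barrierDeriv2 (A lam : ℝ) (m : ℕ) (ρ : ℝ) : ℝ :=
  lam * m * (4 / (3 * A)) ^ 2 * barrierVar A ρ ^ (m - 2) * (barrierVar A ρ + 1) ^ 3 *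
    ((m - 1) * (barrierVar A ρ + 1) + 2 * barrierVar A ρ)

theorem hasDerivAt_barrierDeriv {A lam ρ : ℝ} {m : ℕ} (hm : 2 ≤ m) (hA : 0 < A) (hρ : ρ < A)
    (h : A / 4 < ρ) : HasDerivAt (barrierDeriv A lam m) (barrierDeriv2 A lam m ρ) ρ := by
  have hz := hasDerivAt_barrierVar hA hρ
  have h1 : barrierDeriv A lam m =ᶠ[𝓝 ρ] fun ρ =>
      lam * (m * barrierVar A ρ ^ (m - 1) * (4 / (3 * A) * (barrierVar A ρ + 1) ^ 2)) := by
    filter_upwards [lt_mem_nhds h, gt_mem_nhds hρ] with s h1 h2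
    rw [barrierDeriv, max_eq_left (barrierVar_pos h2 h1).le]
  have h2 := (((hz.pow (m - 1)).const_mul (m : ℝ)).mul
    (((hz.add_const 1).pow 2).const_mul (4 / (3 * A)))).const_mul lam
  refine (h2.congr_deriv ?_).congr_of_eventuallyEq h1
  obtain ⟨j, rfl⟩ := Nat.exists_eq_add_of_le' hm
  simp only [barrierDeriv2, Pi.pow_apply, Nat.add_sub_cancel, show j + 2 - 1 = j + 1 by omega]
  push_cast
  ring

/-- The algebraic inequality behind the supersolution property of `barrier`. -/
theorem barrierVar_ineq {z e d : ℝ} {m : ℕ} (hz : 0 < z) (hm : 2 ≤ m) (hd : 0 ≤ d)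
    (h1 : 1 ≤ ((m : ℝ) - 1) * e) (h2 : m * e + e + 1 ≤ m * d) :
    (z + 1) ^ 2 / z * (z ^ (m - 1) * (z + 1) ^ 2) ^ e ≤ (2 ^ m) ^ d * (1 + z ^ m) ^ d := by
  have hz1 : 1 ≤ z + 1 := by linarith
  have hz0 : 0 < z + 1 := by linarith
  have hA : (z + 1) ^ m ≤ 2 ^ m * (1 + z ^ m) := by
    rcases le_total z 1 with h | h
    · calc (z + 1) ^ m ≤ 2 ^ m := by gcongr; linarith
        _ ≤ 2 ^ m * (1 + z ^ m) := le_mul_of_one_le_right (by positivity)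
            (by linarith [pow_pos hz m])
    · calc (z + 1) ^ m ≤ (2 * z) ^ m := by gcongr; linarith
        _ = 2 ^ m * z ^ m := mul_pow _ _ _
        _ ≤ _ := by gcongr; linarith
  have hcast : ((m - 1 : ℕ) : ℝ) = m - 1 := by rw [Nat.cast_sub (by omega), Nat.cast_one]
  have hpow : (z ^ (m - 1) * (z + 1) ^ 2) ^ e = z ^ ((m - 1) * e) * (z + 1) ^ (2 * e) := by
    rw [Real.mul_rpow (by positivity) (by positivity), ← Real.rpow_natCast,
      ← Real.rpow_natCast (z + 1), ← Real.rpow_mul hz.le, ← Real.rpow_mul hz0.le, hcast]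
    norm_num
  calc (z + 1) ^ 2 / z * (z ^ (m - 1) * (z + 1) ^ 2) ^ e
      = (z + 1) ^ 2 * (z + 1) ^ (2 * e) * z ^ ((m - 1) * e - 1) := by
        rw [hpow, Real.rpow_sub_one hz.ne']; field_simp
    -- By `h1` the exponent is nonnegative; this absorbs the factor 1/z, singular where the barrier
    -- becomes flat.
    _ ≤ (z + 1) ^ 2 * (z + 1) ^ (2 * e) * (z + 1) ^ ((m - 1) * e - 1) := by
        gcongr
        linarith
    _ = (z + 1) ^ (m * e + e + 1) := by
        rw [← Real.rpow_natCast, ← Real.rpow_add hz0, ← Real.rpow_add hz0]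
        congr 1
        push_cast; ring
    -- Superlinearity enters here: `h2` says m(d - e) ≥ e + 1, attainable for large m exactly when d
    -- > e.
    _ ≤ (z + 1) ^ (m * d) := Real.rpow_le_rpow_of_exponent_le hz1 h2
    _ = ((z + 1) ^ m) ^ d := by rw [Real.rpow_mul hz0.le, Real.rpow_natCast]
    _ ≤ (2 ^ m * (1 + z ^ m)) ^ d := by gcongr
    _ = _ := Real.mul_rpow (by positivity) (by positivity)

/-- A linear combination of the derivatives of the barrier is bounded by its first derivative. -/
theorem barrier_second_order_le {A lam ρ a b : ℝ} {m : ℕ} (hm : 2 ≤ m) (hlam : 0 < lam)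
    (hA : 0 < A) (hρ : ρ < A) (h : A / 4 < ρ) (ha : 0 ≤ a) (hb : 0 ≤ b) :
    a * (2 * barrierDeriv A lam m ρ + 4 * ρ * barrierDeriv2 A lam m ρ)
      + b * (2 * barrierDeriv A lam m ρ)
      ≤ (2 * a + 2 * b + 16 / 3 * a * (m + 1)) *
        ((barrierVar A ρ + 1) ^ 2 / barrierVar A ρ * barrierDeriv A lam m ρ) := by
  have hz := barrierVar_pos hρ h
  rw [barrierDeriv, barrierDeriv2, max_eq_left hz.le]
  set z := barrierVar A ρ with hzdef
  have hρ0 : 0 < ρ := by linarith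
  obtain ⟨j, rfl⟩ := Nat.exists_eq_add_of_le' hm
  simp only [Nat.add_sub_cancel, show j + 2 - 1 = j + 1 by omega]
  -- Common factor of both derivatives; what remains is polynomial in z and ρ/A, with ρ < A.
  set W := lam * ((j + 2 : ℕ) : ℝ) * (4 / (3 * A)) * z ^ j * (z + 1) ^ 2 with hW
  have hW0 : 0 ≤ W := by positivity
  have hA4 : ρ * (4 / (3 * A)) ≤ 4 / 3 := by
    rw [mul_div_assoc', div_le_div_iff₀ (by positivity) (by norm_num)]
    linarith
  have e1 : lam * (((j + 2 : ℕ) : ℝ) * z ^ (j + 1) * (4 / (3 * A) * (z + 1) ^ 2)) = W * z := by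
    rw [hW]; ring
  have e2 : 4 * ρ * (lam * ((j + 2 : ℕ) : ℝ) * (4 / (3 * A)) ^ 2 * z ^ j * (z + 1) ^ 3 *
      ((((j + 2 : ℕ) : ℝ) - 1) * (z + 1) + 2 * z))
      = W * (4 * (ρ * (4 / (3 * A))) * ((z + 1) * ((((j + 2 : ℕ) : ℝ) - 1) * (z + 1) + 2 * z))) := by
    rw [hW]; ring
  have e3 : (z + 1) ^ 2 / z * (W * z) = W * (z + 1) ^ 2 := by field_simp
  rw [e1, e2, e3]
  have h1 : z ≤ (z + 1) ^ 2 := by nlinarith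
  set M : ℝ := ((j + 2 : ℕ) : ℝ) with hM
  have hM1 : 2 ≤ M := by rw [hM]; exact_mod_cast hm
  have h2 : (z + 1) * ((M - 1) * (z + 1) + 2 * z) ≤ (M + 1) * (z + 1) ^ 2 := by nlinarith
  have h2' : 0 ≤ (z + 1) * ((M - 1) * (z + 1) + 2 * z) := by
    have : 0 ≤ M - 1 := by linarith
    positivity
  have h3 : 4 * (ρ * (4 / (3 * A))) * ((z + 1) * ((M - 1) * (z + 1) + 2 * z))
      ≤ 16 / 3 * ((M + 1) * (z + 1) ^ 2) :=
    mul_le_mul (by linarith) h2 h2' (by norm_num)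
  have h4 : a * (2 * z + 4 * (ρ * (4 / (3 * A))) * ((z + 1) * ((M - 1) * (z + 1) + 2 * z)))
      + b * (2 * z) ≤ (2 * a + 2 * b + 16 / 3 * a * (M + 1)) * (z + 1) ^ 2 := by
    have h5 := mul_le_mul_of_nonneg_left h3 ha
    have h6 := mul_le_mul_of_nonneg_left h1 ha
    have h7 := mul_le_mul_of_nonneg_left h1 hb
    linarith
  have h5 := mul_le_mul_of_nonneg_left h4 hW0
  linarith

/-- Conversion of the bound on second derivatives into the supersolution inequality. -/
theorem rpow_mul_le_of_second_order_le {p α β d c C R lam r z D Q : ℝ} {m : ℕ} (hm : 2 ≤ m)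
    (he0 : 0 < p - 1 - β) (hde : 0 < d - (p - 1 - β)) (hc : 0 < c) (hC : 0 < C) (hR : 0 < R)
    (hlam : 0 < lam) (hr1 : R / 2 < r) (hr2 : r < R) (hz : 0 < z)
    (hm1e : 1 ≤ ((m : ℝ) - 1) * (p - 1 - β))
    (hmd : m * (p - 1 - β) + (p - 1 - β) + 1 ≤ m * d)
    (hK : C * (8 * m / 3) ^ (p - 1 - β) * (2 ^ m) ^ d / (c * min 1 ((1 / 2 : ℝ) ^ α)) *
      R ^ (-(p - β + α)) ≤ lam ^ (d - (p - 1 - β)))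
    (hder : D = lam * (m * z ^ (m - 1) * (4 / (3 * R ^ 2) * (z + 1) ^ 2)))
    (hQ : Q ≤ C * ((z + 1) ^ 2 / z * D)) :
    (2 * D * r) ^ (p - 2) * Q
      ≤ c * r ^ α * (2 * D * r) ^ β * (lam * (1 + z ^ m)) ^ d := by
  have hr0 : 0 < r := by linarith
  have hA : 0 < R ^ 2 := by positivity
  have hm0 : (0 : ℝ) < m := by exact_mod_cast (by omega : 0 < m)
  have hD0 : 0 < D := by rw [hder]; positivity
  -- On R/2 < r < R the constant μ gives r^α ≥ μ R^α for either sign of α. Below, N is the length of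
  -- the barrier's gradient.
  obtain ⟨μ, hμ⟩ : ∃ μ, μ = min 1 ((1 / 2 : ℝ) ^ α) := ⟨_, rfl⟩
  obtain ⟨e, he⟩ : ∃ e, e = p - 1 - β := ⟨_, rfl⟩
  obtain ⟨N, hN⟩ : ∃ N, N = 2 * D * r := ⟨_, rfl⟩
  rw [← he] at he0 hde hm1e hmd
  rw [← he, ← hμ] at hK
  rw [← hN]
  have hμ0 : 0 < μ := by rw [hμ]; positivity
  have hN0 : 0 < N := by rw [hN]; positivity
  have hvar := barrierVar_ineq hz hm (by linarith : 0 ≤ d) hm1e hmd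
  have hNle : N ≤ 8 * m / 3 * (lam / R) * (z ^ (m - 1) * (z + 1) ^ 2) := by
    have h1 : N = 8 * m / 3 * lam * (r / R ^ 2) * (z ^ (m - 1) * (z + 1) ^ 2) := by
      rw [hN, hder]; field_simp; ring
    have h2 : r / R ^ 2 ≤ 1 / R := by
      rw [div_le_div_iff₀ hA hR]; nlinarith
    rw [h1]
    calc 8 * m / 3 * lam * (r / R ^ 2) * (z ^ (m - 1) * (z + 1) ^ 2)
        ≤ 8 * m / 3 * lam * (1 / R) * (z ^ (m - 1) * (z + 1) ^ 2) := by gcongr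
      _ = _ := by ring
  have hrα : μ * R ^ α ≤ r ^ α := by
    rcases le_total 0 α with h | h
    · calc μ * R ^ α ≤ (1 / 2) ^ α * R ^ α := by gcongr; exact hμ ▸ min_le_right _ _
        _ = (1 / 2 * R) ^ α := (Real.mul_rpow (by norm_num) hR.le).symm
        _ ≤ r ^ α := Real.rpow_le_rpow (by positivity) (by linarith) h
    · calc μ * R ^ α ≤ 1 * R ^ α := by gcongr; exact hμ ▸ min_le_left _ _
        _ = R ^ α := one_mul _
        _ ≤ r ^ α := Real.rpow_le_rpow_of_nonpos hr0 hr2.le h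
  have hlamd : C * (8 * m / 3) ^ e * (2 ^ m) ^ d * ((1 / R) * (lam / R) ^ e)
      ≤ c * μ * R ^ α * lam ^ d := by
    have h1 : R ^ (-(p - β + α)) = (1 / R) * (1 / R) ^ e * (R ^ α)⁻¹ := by
      rw [one_div, Real.inv_rpow hR.le, ← Real.rpow_neg_one, ← Real.rpow_neg hR.le,
        ← Real.rpow_neg hR.le, ← Real.rpow_add hR, ← Real.rpow_add hR]
      congr 1
      rw [he]; ring
    have h2 : lam ^ d = lam ^ (d - e) * lam ^ e := by rw [← Real.rpow_add hlam]; ring_nf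
    have h3 : (lam / R) ^ e = lam ^ e * (1 / R) ^ e := by
      rw [← Real.mul_rpow hlam.le (by positivity), mul_one_div]
    have hRα : 0 < R ^ α := by positivity
    rw [h1, div_mul_eq_mul_div, div_le_iff₀ (by positivity), ← mul_assoc,
      mul_inv_le_iff₀ hRα] at hK
    rw [h2, h3]
    have h4 : 0 < lam ^ e := by positivity
    have h5 := mul_le_mul_of_nonneg_right hK h4.le
    linarith
  have hmain : C * (z + 1) ^ 2 / z * (1 / R) * N ^ e ≤ c * r ^ α * (lam * (1 + z ^ m)) ^ d := by
    calc C * (z + 1) ^ 2 / z * (1 / R) * N ^ e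
        ≤ C * (z + 1) ^ 2 / z * (1 / R) *
          (8 * m / 3 * (lam / R) * (z ^ (m - 1) * (z + 1) ^ 2)) ^ e := by gcongr
      _ = C * (8 * m / 3) ^ e * ((1 / R) * (lam / R) ^ e) *
          ((z + 1) ^ 2 / z * (z ^ (m - 1) * (z + 1) ^ 2) ^ e) := by
          rw [Real.mul_rpow (by positivity) (by positivity),
            Real.mul_rpow (by positivity) (by positivity)]
          ring
      _ ≤ C * (8 * m / 3) ^ e * ((1 / R) * (lam / R) ^ e) * ((2 ^ m) ^ d * (1 + z ^ m) ^ d) :=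
          mul_le_mul_of_nonneg_left hvar (by positivity)
      _ = C * (8 * m / 3) ^ e * (2 ^ m) ^ d * ((1 / R) * (lam / R) ^ e) * (1 + z ^ m) ^ d := by ring
      _ ≤ c * μ * R ^ α * lam ^ d * (1 + z ^ m) ^ d :=
          mul_le_mul_of_nonneg_right hlamd (by positivity)
      _ = c * (μ * R ^ α) * (lam * (1 + z ^ m)) ^ d := by
          rw [Real.mul_rpow hlam.le (by positivity)]; ring
      _ ≤ _ := mul_le_mul_of_nonneg_right (mul_le_mul_of_nonneg_left hrα hc.le) (by positivity)
  have hNpow : N ^ (p - 2) * N = N ^ β * N ^ e := by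
    rw [← Real.rpow_add_one hN0.ne', ← Real.rpow_add hN0]
    congr 1
    rw [he]; ring
  have hDN : D ≤ N * (1 / R) := by
    rw [hN, mul_one_div, le_div_iff₀ hR]
    nlinarith
  have hz2 : 0 ≤ (z + 1) ^ 2 / z := by positivity
  calc N ^ (p - 2) * Q ≤ N ^ (p - 2) * (C * ((z + 1) ^ 2 / z * D)) := by gcongr
    _ ≤ N ^ (p - 2) * (C * ((z + 1) ^ 2 / z * (N * (1 / R)))) := by gcongr
    _ = N ^ (p - 2) * N * (C * (z + 1) ^ 2 / z * (1 / R)) := by ring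
    _ = N ^ β * (C * (z + 1) ^ 2 / z * (1 / R) * N ^ e) := by rw [hNpow]; ring
    _ ≤ N ^ β * (c * r ^ α * (lam * (1 + z ^ m)) ^ d) := by gcongr
    _ = c * r ^ α * N ^ β * (lam * (1 + z ^ m)) ^ d := by ring

/-- For large amplitudes the barrier is a supersolution. -/
theorem exists_barrier_supersolution {p α β d c b : ℝ} (hp : 1 < p) (hβ : β < p - 1)
    (hd : p - 1 - β < d) (hc : 0 < c) (hb : 0 ≤ b) :
    ∃ m : ℕ, 2 ≤ m ∧ 1 / (p - 1) < (m : ℝ) - 1 ∧ ∃ K : ℝ, 0 < K ∧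
      ∀ R lam r : ℝ, 0 < R → 0 < lam → R / 2 < r → r < R →
      K * R ^ (-(p - β + α)) ≤ lam ^ (d - (p - 1 - β)) →
      0 < barrierDeriv (R ^ 2) lam m (r ^ 2) ∧
      (2 * barrierDeriv (R ^ 2) lam m (r ^ 2) * r) ^ (p - 2) *
        ((p - 1) * (2 * barrierDeriv (R ^ 2) lam m (r ^ 2)
          + 4 * r ^ 2 * barrierDeriv2 (R ^ 2) lam m (r ^ 2))
          + b * (2 * barrierDeriv (R ^ 2) lam m (r ^ 2)))
      ≤ c * r ^ α * (2 * barrierDeriv (R ^ 2) lam m (r ^ 2) * r) ^ β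
        * barrier (R ^ 2) lam m (r ^ 2) ^ d := by
  have he0 : 0 < p - 1 - β := by linarith
  have hde : 0 < d - (p - 1 - β) := by linarith
  have hp1 : 0 < p - 1 := by linarith
  -- The summands secure in turn m ≥ 2, m - 1 > 1/(p-1) for the flat sphere, (m-1)e ≥ 1 and m(d-e) ≥
  -- e+1, where e = p-1-β.
  obtain ⟨m, hm⟩ := exists_nat_gt
    (2 + 1 / (p - 1) + 1 / (p - 1 - β) + (p - 1 - β + 1) / (d - (p - 1 - β)))
  have q1 : 0 < 1 / (p - 1) := by positivity
  have q2 : 0 < 1 / (p - 1 - β) := by positivity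
  have q3 : 0 < (p - 1 - β + 1) / (d - (p - 1 - β)) := by positivity
  have hm2 : 2 ≤ m := by
    have : (2 : ℝ) < m := by linarith
    exact_mod_cast this.le
  have hm1e : 1 ≤ ((m : ℝ) - 1) * (p - 1 - β) := by
    have : 1 / (p - 1 - β) ≤ (m : ℝ) - 1 := by linarith
    rwa [div_le_iff₀ he0] at this
  have hmd : m * (p - 1 - β) + (p - 1 - β) + 1 ≤ m * d := by
    have : (p - 1 - β + 1) / (d - (p - 1 - β)) ≤ m := by linarith
    rw [div_le_iff₀ hde] at this
    linarith
  have hC0 : 0 < 2 * (p - 1) + 2 * b + 16 / 3 * (p - 1) * (m + 1) := by positivity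
  refine ⟨m, hm2, by linarith, (2 * (p - 1) + 2 * b + 16 / 3 * (p - 1) * (m + 1)) *
    (8 * m / 3) ^ (p - 1 - β) * (2 ^ m) ^ d / (c * min 1 ((1 / 2 : ℝ) ^ α)), by positivity, ?_⟩
  intro R lam r hR hlam hr1 hr2 hK
  have hA : 0 < R ^ 2 := by positivity
  have hρ : r ^ 2 < R ^ 2 := by
    have : 0 < r := by linarith
    gcongr
  have hρ' : R ^ 2 / 4 < r ^ 2 := by nlinarith
  have hz := barrierVar_pos hρ hρ'
  have hder : barrierDeriv (R ^ 2) lam m (r ^ 2) = lam * (m * barrierVar (R ^ 2) (r ^ 2) ^ (m - 1) *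
      (4 / (3 * R ^ 2) * (barrierVar (R ^ 2) (r ^ 2) + 1) ^ 2)) := by
    rw [barrierDeriv, max_eq_left hz.le]
  have hbar : barrier (R ^ 2) lam m (r ^ 2)
      = lam * (1 + barrierVar (R ^ 2) (r ^ 2) ^ m) := by
    rw [barrier, max_eq_left hz.le]
  refine ⟨by have : 0 < m := by omega
             rw [hder]; positivity, ?_⟩
  rw [hbar]
  exact rpow_mul_le_of_second_order_le hm2 he0 hde hc hC0 hR hlam hr1 hr2 hz hm1e hmd hK hder
    (barrier_second_order_le hm2 hlam hA hρ hρ' hp1.le hb)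

/-- The positive part of `barrierVar` vanishes at least linearly at the sphere |x| = R/2, so the
gradient of its m-th power vanishes to order m - 1. Restricting to |x| < 3R/4 keeps `barrierVar` + 1
below 3. -/
theorem norm_fderiv_barrier_le {R lam : ℝ} {m : ℕ} (hm : 2 ≤ m) (hR : 0 < R) (hlam : 0 < lam)
    {x₀ : E n} (hx₀ : ‖x₀‖ = R / 2) :
    ∀ᶠ x in 𝓝 x₀, DifferentiableAt ℝ (fun x : E n => barrier (R ^ 2) lam m (‖x‖ ^ 2)) x ∧
      ‖fderiv ℝ (fun x : E n => barrier (R ^ 2) lam m (‖x‖ ^ 2)) x‖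
        ≤ lam * (m * (8 / R) ^ (m - 1) * (4 / (3 * R ^ 2) * 3 ^ 2)) * (2 * R)
          * ‖x - x₀‖ ^ ((m : ℝ) - 1) := by
  have hA : 0 < R ^ 2 := by positivity
  have hlt : ∀ᶠ x in 𝓝 x₀, ‖x‖ < 3 / 4 * R :=
    (continuous_norm.tendsto x₀).eventually (gt_mem_nhds (by rw [hx₀]; linarith))
  filter_upwards [hlt] with x hx
  have hx0 := norm_nonneg x
  have hρ : ‖x‖ ^ 2 < R ^ 2 := by nlinarith
  have hfd := hasFDerivAt_comp_norm_sq (x := x) (hasDerivAt_barrier (lam := lam) hm hA hρ)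
  refine ⟨hfd.differentiableAt, ?_⟩
  have hgap : R ^ 2 / 4 ≤ R ^ 2 - ‖x‖ ^ 2 := by nlinarith
  have hgap0 : 0 < R ^ 2 - ‖x‖ ^ 2 := by linarith
  have hz1 : barrierVar (R ^ 2) (‖x‖ ^ 2) + 1 = (3 * R ^ 2 / 4) / (R ^ 2 - ‖x‖ ^ 2) := by
    unfold barrierVar
    field_simp
    ring
  have hz1le : barrierVar (R ^ 2) (‖x‖ ^ 2) + 1 ≤ 3 := by
    rw [hz1, div_le_iff₀ hgap0]; linarith
  have hz1ge : 0 ≤ barrierVar (R ^ 2) (‖x‖ ^ 2) + 1 := by rw [hz1]; positivity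
  have hdiff : |‖x‖ ^ 2 - R ^ 2 / 4| ≤ ‖x - x₀‖ * (2 * R) := by
    have h1 : ‖x‖ ^ 2 - R ^ 2 / 4 = (‖x‖ - ‖x₀‖) * (‖x‖ + ‖x₀‖) := by rw [hx₀]; ring
    rw [h1, abs_mul]
    refine mul_le_mul (abs_norm_sub_norm_le x x₀) ?_ (abs_nonneg _) (norm_nonneg _)
    rw [abs_of_nonneg (by positivity), hx₀]
    linarith
  have hmax : max (barrierVar (R ^ 2) (‖x‖ ^ 2)) 0 ≤ 8 / R * ‖x - x₀‖ := by
    refine max_le ?_ (by positivity)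
    rw [barrierVar, div_le_iff₀ hgap0]
    have h1 := (le_abs_self _).trans hdiff
    calc ‖x‖ ^ 2 - R ^ 2 / 4 ≤ ‖x - x₀‖ * (2 * R) := h1
      _ = 8 / R * ‖x - x₀‖ * (R ^ 2 / 4) := by field_simp; ring
      _ ≤ _ := by gcongr
  have hD : |barrierDeriv (R ^ 2) lam m (‖x‖ ^ 2)|
      ≤ lam * (m * (8 / R * ‖x - x₀‖) ^ (m - 1) * (4 / (3 * R ^ 2) * 3 ^ 2)) := by
    rw [barrierDeriv, abs_of_nonneg (by positivity)]
    gcongr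
  have hcast : ((m : ℝ) - 1) = ((m - 1 : ℕ) : ℝ) := by
    rw [Nat.cast_sub (by omega), Nat.cast_one]
  rw [hfd.fderiv, norm_smul, norm_smul, innerSL_apply_norm, Real.norm_eq_abs, hcast,
    Real.rpow_natCast]
  calc |barrierDeriv (R ^ 2) lam m (‖x‖ ^ 2)| * (‖(2 : ℝ)‖ * ‖x‖)
      ≤ lam * (m * (8 / R * ‖x - x₀‖) ^ (m - 1) * (4 / (3 * R ^ 2) * 3 ^ 2)) * (2 * R) := by
        gcongr
        · norm_num
        · linarith
    _ = _ := by rw [mul_pow]; ring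

/-! ### Comparison with the barrier, Liouville theorem and necessity. -/

/-- Comparison of a subsolution with a barrier which is a supersolution outside the region
where it is constant. -/
theorem IsPSubharmonicOffZero.le_barrier {p α β d c : ℝ} {u : E n → ℝ}
    (h : IsPSubharmonicOffZero p u) (hp : 1 < p) (hn : 0 < n) (hd : 0 < d) (hc : 0 < c)
    (hsub : ∀ x : E n, x ≠ 0 → 0 < u x →
      c * ‖x‖ ^ α * ‖gradient u x‖ ^ β * u x ^ d ≤ pLaplacian p u x)
    {R lam : ℝ} {m : ℕ} (hm : 2 ≤ m) (hmp : 1 / (p - 1) < (m : ℝ) - 1) (hR : 0 < R)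
    (hlam : 0 < lam)
    (hbar : ∀ r, R / 2 < r → r < R →
      0 < barrierDeriv (R ^ 2) lam m (r ^ 2) ∧
      (2 * barrierDeriv (R ^ 2) lam m (r ^ 2) * r) ^ (p - 2) *
        ((p - 1) * (2 * barrierDeriv (R ^ 2) lam m (r ^ 2)
          + 4 * r ^ 2 * barrierDeriv2 (R ^ 2) lam m (r ^ 2))
          + (n - 1) * (2 * barrierDeriv (R ^ 2) lam m (r ^ 2)))
      ≤ c * r ^ α * (2 * barrierDeriv (R ^ 2) lam m (r ^ 2) * r) ^ β
        * barrier (R ^ 2) lam m (r ^ 2) ^ d)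
    {x : E n} (hx : ‖x‖ < R) : u x ≤ barrier (R ^ 2) lam m (‖x‖ ^ 2) := by
  by_contra! hgt
  have hA : 0 < R ^ 2 := by positivity
  have hcont : Continuous u := h.differentiable.continuous
  obtain ⟨M, hM⟩ := (isCompact_closedBall (0 : E n) R).bddAbove_image hcont.continuousOn
  have hM : ∀ y : E n, ‖y‖ ≤ R → u y ≤ M := fun y hy =>
    hM (mem_image_of_mem u (mem_closedBall_zero_iff.mpr hy))
  have hM0 : 0 < M := (hlam.trans_le (amplitude_le_barrier hlam.le)).trans (hgt.trans_le (hM x hx.le))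
  set Z := 1 + M / lam with hZ
  have hZ1 : 1 ≤ Z := by have : 0 < M / lam := by positivity
                         linarith
  -- The solution of `barrierVar (R ^ 2) ρ₁ = Z`; beyond it the barrier is at least lam(1 + Z) > M ≥
  -- u, so the maximum of u - v is interior.
  set ρ₁ := (Z + 1 / 4) * R ^ 2 / (1 + Z) with hρ₁
  have hρ₁0 : 0 < ρ₁ := by positivity
  have hρ₁A : ρ₁ < R ^ 2 := by
    rw [hρ₁, div_lt_iff₀ (by positivity)]; nlinarith
  have hout : ∀ y : E n, ρ₁ ≤ ‖y‖ ^ 2 → ‖y‖ < R → u y < barrier (R ^ 2) lam m (‖y‖ ^ 2) := by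
    intro y hy1 hy2
    have hy3 : ‖y‖ ^ 2 < R ^ 2 := by have := norm_nonneg y; gcongr
    have hzZ : Z ≤ barrierVar (R ^ 2) (‖y‖ ^ 2) := by
      rw [barrierVar, le_div_iff₀ (by linarith)]
      rw [hρ₁, div_le_iff₀ (by positivity)] at hy1
      linarith
    have hpow : Z ≤ max (barrierVar (R ^ 2) (‖y‖ ^ 2)) 0 ^ m := by
      rw [max_eq_left (by linarith)]
      exact hzZ.trans (le_self_pow₀ (hZ1.trans hzZ) (by omega))
    calc u y ≤ M := hM y hy2.le
      _ = lam * (M / lam) := by field_simp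
      _ < lam * (1 + Z) := by gcongr; linarith
      _ ≤ _ := by unfold barrier; gcongr
  set v : E n → ℝ := fun y => barrier (R ^ 2) lam m (‖y‖ ^ 2) with hv
  set r₁ := √ρ₁ with hr₁
  have hr₁sq : r₁ ^ 2 = ρ₁ := Real.sq_sqrt hρ₁0.le
  have hr₁0 : 0 ≤ r₁ := Real.sqrt_nonneg _
  have hr₁R : r₁ < R := by
    rw [hr₁, Real.sqrt_lt' hR]; exact hρ₁A
  have hxr : ‖x‖ ≤ r₁ := by
    by_contra! hcon
    refine absurd (hout x ?_ hx) (not_lt.mpr hgt.le)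
    rw [← hr₁sq]; gcongr
  have hvd : ∀ y : E n, ‖y‖ < R → HasFDerivAt v
      (barrierDeriv (R ^ 2) lam m (‖y‖ ^ 2) • (2 : ℝ) • innerSL ℝ y) y := fun y hy =>
    hasFDerivAt_comp_norm_sq (hasDerivAt_barrier hm hA (by have := norm_nonneg y; gcongr))
  obtain ⟨x₀, hx₀, hx₀max⟩ := (isCompact_closedBall (0 : E n) r₁).exists_isMaxOn
    ⟨x, mem_closedBall_zero_iff.mpr hxr⟩ (f := fun y => u y - v y)
    (fun y hy => (hcont.continuousAt.sub (hvd y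
      ((mem_closedBall_zero_iff.mp hy).trans_lt hr₁R)).continuousAt).continuousWithinAt)
  rw [mem_closedBall_zero_iff] at hx₀
  have hx₀gt : v x₀ < u x₀ := by
    have := hx₀max (mem_closedBall_zero_iff.mpr hxr)
    simp only [mem_ofPred_eq] at this
    have h2 : v x < u x := hgt
    linarith
  have hx₀R : ‖x₀‖ < R := hx₀.trans_lt hr₁R
  have hx₀lt : ‖x₀‖ < r₁ := by
    refine lt_of_le_of_ne hx₀ fun heq => ?_
    exact absurd (hout x₀ (by rw [heq, hr₁sq]) hx₀R) (not_lt.mpr hx₀gt.le)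
  have hmax : IsLocalMax (fun y => u y - v y) x₀ := by
    filter_upwards [Metric.isOpen_ball.mem_nhds (mem_ball_zero_iff.mpr hx₀lt)] with y hy
    exact hx₀max (Metric.ball_subset_closedBall hy)
  -- Flat region: maximum principle. Interface: order of growth at a critical point. Annulus:
  -- second-order comparison, made strict by u(x₀) > v(x₀) and d > 0.
  rcases lt_trichotomy ‖x₀‖ (R / 2) with hlt | heq | hgt'
  · refine h.not_isLocalMax hp hn x₀ ?_
    filter_upwards [hmax, Metric.isOpen_ball.mem_nhds (mem_ball_zero_iff.mpr hlt)] with y hy1 hy2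
    rw [mem_ball_zero_iff] at hy2
    have hflat : ∀ w : E n, ‖w‖ < R / 2 → v w = lam := fun w hw => by
      have := norm_nonneg w
      exact barrier_of_le hm (by nlinarith) (by nlinarith)
    rw [hflat y hy2, hflat x₀ hlt] at hy1
    linarith
  · have hx₀0 : x₀ ≠ 0 := by rw [← norm_pos_iff, heq]; positivity
    have hg : gradient u x₀ = 0 := by
      have h1 := hmax.hasFDerivAt_eq_zero ((h.differentiable x₀).hasFDerivAt.sub (hvd x₀ hx₀R))
      rw [barrierDeriv_of_le hm (by rw [heq]; nlinarith) (by rw [heq]; linarith), zero_smul,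
        sub_zero] at h1
      simp [gradient, h1]
    exact not_isLocalMax_sub_of_critical hp h.differentiable (h.differentiableAt_pGrad x₀ hx₀0) hg
      (h.pLaplacian_pos x₀ hx₀0) hmp (norm_fderiv_barrier_le hm hR hlam heq) hmax
  · have hx₀0 : x₀ ≠ 0 := by rw [← norm_pos_iff]; linarith
    have hρ : ‖x₀‖ ^ 2 < R ^ 2 := by have := norm_nonneg x₀; gcongr
    have hρ' : R ^ 2 / 4 < ‖x₀‖ ^ 2 := by nlinarith
    obtain ⟨hD, hsup⟩ := hbar ‖x₀‖ hgt' hx₀R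
    obtain ⟨hg, hle⟩ := pLaplacian_le_of_touching hp hx₀0 (h.contDiffAt_two hx₀0)
      (by filter_upwards [gt_mem_nhds hρ] with ρ hρ2 using hasDerivAt_barrier hm hA hρ2)
      (hasDerivAt_barrierDeriv hm hA hρ hρ') hD.ne' hmax
    have hnorm : ‖gradient u x₀‖ = 2 * barrierDeriv (R ^ 2) lam m (‖x₀‖ ^ 2) * ‖x₀‖ := by
      rw [hg, norm_smul, Real.norm_of_nonneg (by positivity)]
    have hv0 : 0 < v x₀ := hlam.trans_le (amplitude_le_barrier hlam.le)
    have hs := hsub x₀ hx₀0 (hv0.trans hx₀gt)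
    have hx₀p : 0 < ‖x₀‖ := norm_pos_iff.mpr hx₀0
    have hstrict : c * ‖x₀‖ ^ α * ‖gradient u x₀‖ ^ β * v x₀ ^ d
        < c * ‖x₀‖ ^ α * ‖gradient u x₀‖ ^ β * u x₀ ^ d := by
      have : 0 < ‖gradient u x₀‖ := by rw [hnorm]; positivity
      gcongr
    rw [hnorm] at hs hle hstrict
    exact absurd (hs.trans (hle.trans hsup)) (not_le.mpr hstrict)

/-- **Keller–Osserman type Liouville theorem**: nonexistence for superlinear growth. -/
theorem IsPSubharmonicOffZero.eq_zero {p α β d c : ℝ} {u : E n → ℝ}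
    (h : IsPSubharmonicOffZero p u) (hp : 1 < p) (hn : 0 < n) (hα : -1 < α) (hβ : β < p - 1)
    (hd : p - 1 - β < d) (hc : 0 < c)
    (hsub : ∀ x : E n, x ≠ 0 → 0 < u x →
      c * ‖x‖ ^ α * ‖gradient u x‖ ^ β * u x ^ d ≤ pLaplacian p u x)
    (hu : ∀ x, 0 ≤ u x) (x : E n) : u x = 0 := by
  have hb : (0 : ℝ) ≤ (n : ℝ) - 1 := by
    have : (1 : ℝ) ≤ n := by exact_mod_cast hn
    linarith
  obtain ⟨m, hm, hmp, K, hK, hbar⟩ := exists_barrier_supersolution (α := α) hp hβ hd hc hb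
  set γ := d - (p - 1 - β) with hγ
  have hγ0 : 0 < γ := by linarith
  -- The smallest amplitude allowed by the supersolution condition; α > -1 and p - β > 1 make it
  -- tend to 0.
  set lam : ℝ → ℝ := fun R => (K * R ^ (-(p - β + α))) ^ (1 / γ) with hlam
  have hlim : Tendsto lam atTop (𝓝 0) := by
    have h1 := (tendsto_rpow_neg_atTop (by linarith : 0 < p - β + α)).const_mul K
    rw [mul_zero] at h1
    have h2 := h1.rpow_const (p := 1 / γ) (Or.inr (by positivity))
    rwa [Real.zero_rpow (by positivity)] at h2
  refine le_antisymm (ge_of_tendsto hlim ?_) (hu x)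
  filter_upwards [eventually_gt_atTop (2 * ‖x‖), eventually_gt_atTop 0] with R hR1 hR0
  have hbase : 0 < K * R ^ (-(p - β + α)) := by positivity
  have hlam0 : 0 < lam R := by positivity
  have hpow : lam R ^ γ = K * R ^ (-(p - β + α)) := by
    rw [hlam, ← Real.rpow_mul hbase.le, one_div_mul_cancel hγ0.ne', Real.rpow_one]
  have hle := h.le_barrier hp hn (by linarith) hc hsub hm hmp hR0 hlam0
    (fun r hr1 hr2 => hbar R (lam R) r hR0 hlam0 hr1 hr2 hpow.ge) (x := x)
    (by have := norm_nonneg x; linarith)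
  have hx := norm_nonneg x
  rwa [barrier_of_le hm (by nlinarith) (by nlinarith)] at hle

theorem neg_one_lt_of_exponentCondition {c p α β : ℝ} (hc : -1 < c)
    (h : ExponentCondition c p α β) : -1 < α := by
  rcases h with h | h
  · exact hc.trans_le h.1
  · exact h.1

/-- Necessity, for any operator controlled by the trace on its cone. -/
theorem le_of_hasNonnegNontrivialSubsolution {p α β d C : ℝ} {cone : Set (Multiset ℝ)}
    {F : Multiset ℝ → ℝ} (hp : 1 < p) (hn : 0 < n) (hα : -1 < α) (hβ : β < p - 1)
    (hC : 0 < C)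
    (hF : ∀ l ∈ cone, Multiset.card l = n ∧ 0 < l.sum ∧ F l ≤ C * l.sum)
    (h : HasNonnegNontrivialSubsolution n p α β (powerNonlin d) cone F) : d ≤ p - β - 1 := by
  by_contra! hd
  obtain ⟨u, hu, hnn, x, hx⟩ := h
  have htr : ∀ x : E n, x ≠ 0 → pLaplacian p u x = (pHessEigenvalues p u x).sum := fun x hx =>
    trace_eq_sum_pHessEigenvalues (hF _ (hu.admissible x (Or.inl hx))).1
  have hps : IsPSubharmonicOffZero p u :=
    { contDiff_one := hu.regular.contDiff_one
      contDiffOn_two := hu.regular.contDiffOn_two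
      differentiableAt_pGrad := fun x hx =>
        ((hu.regular.pGrad_contDiffOn x hx).contDiffAt
          (isOpen_compl_singleton.mem_nhds hx)).differentiableAt (by norm_num)
      pLaplacian_pos := fun x hx => by
        rw [htr x hx]
        exact (hF _ (hu.admissible x (Or.inl hx))).2.1 }
  refine hx (hps.eq_zero (α := α) (β := β) (d := d) (c := C⁻¹) hp hn hα hβ (by linarith)
    (by positivity) (fun y hy hpos => ?_) hnn x)
  have h1 := hu.subsolution y (Or.inl hy)
  rw [powerNonlin, if_pos hpos] at h1
  have h2 := (hF _ (hu.admissible y (Or.inl hy))).2.2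
  rw [htr y hy, mul_assoc, mul_assoc, inv_mul_le_iff₀ hC, ← mul_assoc]
  exact h1.trans h2

/-! ### The explicit subsolution exp(a|x|^μ). -/

/-- The radial function `exp (a |x|^μ)`. -/
def expPow (n : ℕ) (a μ : ℝ) (x : E n) : ℝ := Real.exp (a * ‖x‖ ^ μ)

/-- The radial field `exp (b |x|^μ) |x|^s x`. -/
def expField (n : ℕ) (b μ s : ℝ) (x : E n) : E n := Real.exp (b * ‖x‖ ^ μ) • (‖x‖ ^ s • x)

theorem contDiff_expPow (a : ℝ) {μ : ℝ} (hμ : 1 < μ) : ContDiff ℝ 1 (expPow n a μ) :=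
  (contDiff_const.mul (contDiff_norm_rpow hμ)).exp

theorem hasGradientAt_expPow (a : ℝ) {μ : ℝ} (hμ : 1 < μ) (x : E n) :
    HasGradientAt (expPow n a μ) ((a * μ) • expField n a μ (μ - 2) x) x := by
  rw [hasGradientAt_iff_hasFDerivAt]
  refine (((hasFDerivAt_norm_rpow x hμ).const_mul a).exp).congr_fderiv ?_
  ext v
  simp only [expField, smul_apply, innerSL_apply_apply, smul_eq_mul,
    InnerProductSpace.toDual_apply_apply, real_inner_smul_left]
  ring

theorem gradient_expPow (a : ℝ) {μ : ℝ} (hμ : 1 < μ) (x : E n) :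
    gradient (expPow n a μ) x = (a * μ) • expField n a μ (μ - 2) x :=
  (hasGradientAt_expPow a hμ x).gradient

theorem norm_gradient_expPow {a μ : ℝ} (ha : 0 < a) (hμ : 1 < μ) {x : E n} (hx : x ≠ 0) :
    ‖gradient (expPow n a μ) x‖ = a * μ * (expPow n a μ x * ‖x‖ ^ (μ - 1)) := by
  have h : 0 < a * μ := by positivity
  rw [gradient_expPow a hμ, expField, norm_smul, norm_smul, norm_rpow_smul hx,
    Real.norm_of_nonneg h.le, Real.norm_of_nonneg (Real.exp_pos _).le, expPow]
  congr 3
  ring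

/-- The family of exponential radial fields is stable under G ↦ |G|^(p-2)G, so one computation of
`expFieldDeriv` serves both the Hessian of u and the derivative of its `p`-gradient. -/
theorem pGrad_expPow {p a μ : ℝ} (ha : 0 < a) (hμ : 1 < μ) :
    pGrad p (expPow n a μ)
      = fun x => (a * μ) ^ (p - 1) • expField n (a * (p - 1)) μ ((μ - 1) * (p - 1) - 1) x := by
  funext x
  rcases eq_or_ne x 0 with rfl | hx
  · simp [pGrad, gradient_expPow a hμ, expField]
  have hr : 0 < ‖x‖ := norm_pos_iff.mpr hx
  have h : 0 < a * μ := by positivity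
  have hE : 0 < expPow n a μ x := Real.exp_pos _
  rw [pGrad, norm_gradient_expPow ha hμ hx, gradient_expPow a hμ, expField, expField,
    smul_smul, smul_smul, smul_smul, smul_smul, smul_smul]
  congr 1
  have e1 : Real.exp (a * (p - 1) * ‖x‖ ^ μ) = expPow n a μ x ^ (p - 1) := by
    rw [expPow, ← Real.exp_mul]; ring_nf
  have e2 : Real.exp (a * ‖x‖ ^ μ) = expPow n a μ x := rfl
  rw [e1, e2, Real.mul_rpow h.le (by positivity), Real.mul_rpow hE.le (by positivity),
    ← Real.rpow_mul hr.le]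
  have e3 : (a * μ) ^ (p - 1) = (a * μ) ^ (p - 2) * (a * μ) := by
    rw [← Real.rpow_add_one h.ne']; ring_nf
  have e4 : expPow n a μ x ^ (p - 1) = expPow n a μ x ^ (p - 2) * expPow n a μ x := by
    rw [← Real.rpow_add_one hE.ne']; ring_nf
  have e5 : ‖x‖ ^ ((μ - 1) * (p - 1) - 1) = ‖x‖ ^ ((μ - 1) * (p - 2)) * ‖x‖ ^ (μ - 2) := by
    rw [← Real.rpow_add hr]; ring_nf
  rw [e3, e4, e5]
  ring

theorem contDiffAt_expPow (a μ : ℝ) {N : WithTop ℕ∞} {x : E n} (hx : x ≠ 0) :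
    ContDiffAt ℝ N (expPow n a μ) x :=
  (contDiffAt_const.mul ((contDiffAt_norm ℝ hx).rpow_const_of_ne (by simpa using hx))).exp

theorem contDiffAt_expField (b μ s : ℝ) {N : WithTop ℕ∞} {x : E n} (hx : x ≠ 0) :
    ContDiffAt ℝ N (expField n b μ s) x :=
  (contDiffAt_expPow b μ hx).smul
    (((contDiffAt_norm ℝ hx).rpow_const_of_ne (by simpa using hx)).smul contDiffAt_id)

/-- The derivative of `|x|^s x`. -/
def normRpowSmulDeriv (s : ℝ) (x : E n) : E n →L[ℝ] E n :=
  ‖x‖ ^ s • ContinuousLinearMap.id ℝ (E n) + ((s * ‖x‖ ^ (s - 2)) • innerSL ℝ x).smulRight x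

theorem hasFDerivAt_norm_rpow_smul_of_ne (s : ℝ) {x : E n} (hx : x ≠ 0) :
    HasFDerivAt (fun x : E n => ‖x‖ ^ s • x) (normRpowSmulDeriv s x) x :=
  (hasFDerivAt_norm_rpow_of_ne hx s).smul (hasFDerivAt_id x)

theorem norm_normRpowSmulDeriv_le (s : ℝ) {x : E n} (hx : x ≠ 0) :
    ‖normRpowSmulDeriv s x‖ ≤ (1 + |s|) * ‖x‖ ^ s := by
  have hr : 0 < ‖x‖ := norm_pos_iff.mpr hx
  refine (norm_add_le _ _).trans ?_
  rw [norm_smul, ContinuousLinearMap.norm_smulRight_apply, norm_smul, innerSL_apply_norm, norm_mul,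
    Real.norm_of_nonneg (by positivity : 0 ≤ ‖x‖ ^ s),
    Real.norm_of_nonneg (by positivity : 0 ≤ ‖x‖ ^ (s - 2)), Real.norm_eq_abs]
  have h1 : |s| * ‖x‖ ^ (s - 2) * ‖x‖ * ‖x‖ = |s| * ‖x‖ ^ s := by
    rw [mul_assoc, mul_assoc, ← sq, ← Real.rpow_natCast, ← Real.rpow_add hr]
    norm_num
  have h2 := mul_le_mul_of_nonneg_left (ContinuousLinearMap.norm_id_le (𝕜 := ℝ) (E := E n))
    (by positivity : 0 ≤ ‖x‖ ^ s)
  rw [h1]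
  linarith

/-- For s > 0 the derivative off 0 is O(|x|^s), so it extends continuously by 0; for s = 0 the map
is the identity. -/
theorem contDiff_norm_rpow_smul {s : ℝ} (hs : 0 ≤ s) :
    ContDiff ℝ 1 (fun x : E n => ‖x‖ ^ s • x) := by
  rcases hs.eq_or_lt with rfl | hs
  · simpa using contDiff_fun_id
  have h0 : normRpowSmulDeriv s (0 : E n) = 0 := by
    ext v
    simp [normRpowSmulDeriv, Real.zero_rpow hs.ne']
  have hlim : Tendsto (fun x : E n => ‖x‖ ^ s) (𝓝 0) (𝓝 0) := by
    have h1 : Continuous fun x : E n => ‖x‖ ^ s := continuous_norm.rpow_const fun _ => Or.inr hs.le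
    simpa [Real.zero_rpow hs.ne'] using h1.tendsto 0
  have hderiv : ∀ x : E n, HasFDerivAt (fun x : E n => ‖x‖ ^ s • x) (normRpowSmulDeriv s x) x := by
    intro x
    rcases eq_or_ne x 0 with rfl | hx
    · rw [h0, hasFDerivAt_iff_isLittleO_nhds_zero]
      simp only [zero_add, norm_zero, smul_zero, sub_zero, zero_apply]
      have h1 := (Asymptotics.isLittleO_one_iff ℝ).mpr hlim
      have h2 := h1.smul_isBigO (Asymptotics.isBigO_refl (fun x : E n => x) (𝓝 0))
      simpa using h2
    · exact hasFDerivAt_norm_rpow_smul_of_ne s hx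
  rw [contDiff_one_iff_fderiv]
  refine ⟨fun x => (hderiv x).differentiableAt, ?_⟩
  rw [funext fun x => (hderiv x).fderiv, continuous_iff_continuousAt]
  intro x
  rcases eq_or_ne x 0 with rfl | hx
  · rw [ContinuousAt, h0, tendsto_zero_iff_norm_tendsto_zero]
    have h1 : Tendsto (fun x : E n => (1 + |s|) * ‖x‖ ^ s) (𝓝 0) (𝓝 0) := by
      simpa using hlim.const_mul (1 + |s|)
    refine squeeze_zero (fun _ => norm_nonneg _) (fun x => ?_) h1
    rcases eq_or_ne x 0 with rfl | hx
    · rw [h0, norm_zero]; positivity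
    · exact norm_normRpowSmulDeriv_le s hx
  · have h1 : ContDiffAt ℝ 1 (fun x : E n => ‖x‖ ^ s • x) x :=
      ((contDiffAt_norm ℝ hx).rpow_const_of_ne (by simpa using hx)).smul contDiffAt_id
    have h2 := (h1.fderiv_right (m := 0) (by norm_num)).continuousAt
    rwa [funext fun x => (hderiv x).fderiv] at h2

theorem contDiff_expField (b : ℝ) {μ s : ℝ} (hμ : 1 < μ) (hs : 0 ≤ s) :
    ContDiff ℝ 1 (expField n b μ s) :=
  (contDiff_expPow b hμ).smul (contDiff_norm_rpow_smul hs)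

/-- The derivative of `expField`. -/
def expFieldDeriv (b μ s : ℝ) (x : E n) : E n →L[ℝ] E n :=
  (Real.exp (b * ‖x‖ ^ μ) * ‖x‖ ^ s) • (ContinuousLinearMap.id ℝ (E n) +
    ((s + b * μ * ‖x‖ ^ μ) * ‖x‖ ^ (-2 : ℝ)) • (innerSL ℝ x).smulRight x)

theorem hasFDerivAt_expField (b : ℝ) {μ : ℝ} (hμ : 1 < μ) (s : ℝ) {x : E n} (hx : x ≠ 0) :
    HasFDerivAt (expField n b μ s) (expFieldDeriv b μ s x) x := by
  have hr : 0 < ‖x‖ := norm_pos_iff.mpr hx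
  refine ((((hasFDerivAt_norm_rpow x hμ).const_mul b).exp).smul
    (hasFDerivAt_norm_rpow_smul_of_ne s hx)).congr_fderiv ?_
  ext1 v
  simp only [expFieldDeriv, normRpowSmulDeriv, add_apply, smul_apply,
    ContinuousLinearMap.smulRight_apply, innerSL_apply_apply, ContinuousLinearMap.id_apply,
    smul_eq_mul, smul_add, smul_smul]
  rw [add_assoc, ← add_smul]
  congr 2
  have e1 : ‖x‖ ^ (μ - 2) = ‖x‖ ^ μ * ‖x‖ ^ (-2 : ℝ) := by rw [← Real.rpow_add hr]; ring_nf
  have e2 : ‖x‖ ^ (s - 2) = ‖x‖ ^ s * ‖x‖ ^ (-2 : ℝ) := by rw [← Real.rpow_add hr]; ring_nf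
  rw [e1, e2]
  ring

theorem inner_expFieldDeriv (b μ s : ℝ) (x v w : E n) :
    inner ℝ (expFieldDeriv b μ s x v) w = (Real.exp (b * ‖x‖ ^ μ) * ‖x‖ ^ s) *
      (inner ℝ v w + (s + b * μ * ‖x‖ ^ μ) * ‖x‖ ^ (-2 : ℝ) * (inner ℝ x v * inner ℝ x w)) := by
  simp only [expFieldDeriv, add_apply, smul_apply,
    ContinuousLinearMap.smulRight_apply, innerSL_apply_apply, ContinuousLinearMap.id_apply,
    inner_add_left, real_inner_smul_left]

theorem isSymmetric_expFieldDeriv (b μ s : ℝ) (x : E n) :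
    (expFieldDeriv b μ s x : E n →ₗ[ℝ] E n).IsSymmetric := by
  intro v w
  rw [ContinuousLinearMap.coe_coe, real_inner_comm (expFieldDeriv b μ s x w) v,
    inner_expFieldDeriv, inner_expFieldDeriv, real_inner_comm]
  ring

/-- Up to the common factor the tangential eigenvalue is 1 and the radial one 1 + s + bμ|x|^μ ≥ 1 +
s; Cauchy–Schwarz treats both at once. -/
theorem le_inner_expFieldDeriv {b μ s : ℝ} (hb : 0 ≤ b) (hμ : 1 < μ) {x : E n}
    (hx : x ≠ 0) (v : E n) :
    Real.exp (b * ‖x‖ ^ μ) * ‖x‖ ^ s * min 1 (1 + s) * ‖v‖ ^ 2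
      ≤ inner ℝ (expFieldDeriv b μ s x v) v := by
  have hr : 0 < ‖x‖ := norm_pos_iff.mpr hx
  rw [inner_expFieldDeriv, mul_assoc _ (min 1 (1 + s))]
  refine mul_le_mul_of_nonneg_left ?_ (by positivity)
  have hcs := real_inner_mul_inner_self_le x v
  rw [real_inner_self_eq_norm_sq, real_inner_self_eq_norm_sq] at hcs
  have e2 : ‖x‖ ^ (-2 : ℝ) = (‖x‖ ^ 2)⁻¹ := by
    rw [Real.rpow_neg hr.le]; norm_num
  have hw : ‖x‖ ^ (-2 : ℝ) * (inner ℝ x v * inner ℝ x v) ≤ ‖v‖ ^ 2 := by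
    rw [e2, inv_mul_le_iff₀ (by positivity)]
    exact hcs
  have hw0 : 0 ≤ ‖x‖ ^ (-2 : ℝ) * (inner ℝ x v * inner ℝ x v) :=
    mul_nonneg (by positivity) (mul_self_nonneg _)
  set W := ‖x‖ ^ (-2 : ℝ) * (inner ℝ x v * inner ℝ x v) with hW
  rw [mul_assoc (s + _), ← hW, real_inner_self_eq_norm_sq]
  have h1 : 0 ≤ b * μ * ‖x‖ ^ μ * W := by positivity
  have h2 : 0 ≤ ‖v‖ ^ 2 := by positivity
  rcases le_total 0 s with hs | hs
  · rw [min_eq_left (by linarith)]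
    have := mul_nonneg hs hw0
    linarith
  · rw [min_eq_right (by linarith)]
    have := mul_le_mul_of_nonpos_left hw hs
    linarith

theorem norm_expFieldDeriv_apply_le (b : ℝ) {μ s : ℝ} {x : E n}
    (hx : x ≠ 0) (v : E n) :
    ‖expFieldDeriv b μ s x v‖
      ≤ Real.exp (b * ‖x‖ ^ μ) * (1 + |s + b * μ * ‖x‖ ^ μ|) * ‖x‖ ^ s * ‖v‖ := by
  have hr : 0 < ‖x‖ := norm_pos_iff.mpr hx
  simp only [expFieldDeriv, add_apply, smul_apply,
    ContinuousLinearMap.smulRight_apply, innerSL_apply_apply, ContinuousLinearMap.id_apply]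
  rw [norm_smul, Real.norm_of_nonneg (by positivity)]
  have e2 : ‖x‖ ^ (-2 : ℝ) = (‖x‖ ^ 2)⁻¹ := by
    rw [Real.rpow_neg hr.le]; norm_num
  have h1 : ‖((s + b * μ * ‖x‖ ^ μ) * ‖x‖ ^ (-2 : ℝ)) • inner ℝ x v • x‖
      ≤ |s + b * μ * ‖x‖ ^ μ| * ‖v‖ := by
    rw [norm_smul, norm_smul, norm_mul, Real.norm_eq_abs, e2, norm_inv, norm_pow, norm_norm,
      mul_assoc]
    refine mul_le_mul_of_nonneg_left ?_ (abs_nonneg _)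
    rw [inv_mul_le_iff₀ (by positivity)]
    calc ‖inner ℝ x v‖ * ‖x‖ ≤ ‖x‖ * ‖v‖ * ‖x‖ := by
          gcongr; exact norm_inner_le_norm x v
      _ = _ := by ring
  calc _ ≤ Real.exp (b * ‖x‖ ^ μ) * ‖x‖ ^ s * (‖v‖ + |s + b * μ * ‖x‖ ^ μ| * ‖v‖) := by
        gcongr
        exact (norm_add_le _ _).trans (by gcongr)
    _ = _ := by ring

theorem contDiff_two_expPow (a : ℝ) {μ : ℝ} (hμ : 2 ≤ μ) : ContDiff ℝ 2 (expPow n a μ) := by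
  have h1 : fderiv ℝ (expPow n a μ)
      = fun x => InnerProductSpace.toDual ℝ (E n) ((a * μ) • expField n a μ (μ - 2) x) :=
    funext fun x => (hasGradientAt_expPow a (by linarith) x).hasFDerivAt.fderiv
  rw [show (2 : WithTop ℕ∞) = 1 + 1 by norm_num, contDiff_succ_iff_fderiv]
  refine ⟨(contDiff_expPow a (by linarith)).differentiable (by norm_num), by simp, ?_⟩
  have h2 : ContDiff ℝ 1 fun x => (a * μ) • expField n a μ (μ - 2) x :=
    (contDiff_expField a (by linarith) (by linarith)).const_smul (a * μ)
  rw [h1]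
  exact (InnerProductSpace.toDual ℝ (E n)).contDiff.comp h2

/-- The eigenvalues for `exp (a |x|^μ)` away from the origin. -/
theorem pHessEigenvalues_expPow {p a μ : ℝ} (hp : 1 < p) (ha : 0 < a) (hμ : 1 < μ) {x : E n}
    (hx : x ≠ 0) :
    Multiset.card (pHessEigenvalues p (expPow n a μ) x) = n ∧
      ∀ y ∈ pHessEigenvalues p (expPow n a μ) x,
        (a * μ) ^ (p - 1) * (expPow n a μ x ^ (p - 1) * ‖x‖ ^ ((μ - 1) * (p - 1) - 1)
          * min 1 ((μ - 1) * (p - 1))) ≤ y := by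
  have hfd : fderiv ℝ (pGrad p (expPow n a μ)) x = (a * μ) ^ (p - 1) •
      expFieldDeriv (a * (p - 1)) μ ((μ - 1) * (p - 1) - 1) x := by
    rw [pGrad_expPow ha hμ]
    exact ((hasFDerivAt_expField _ hμ _ hx).const_smul ((a * μ) ^ (p - 1))).fderiv
  have hK : 0 ≤ (a * μ) ^ (p - 1) := by positivity
  refine card_pHessEigenvalues_of_isSymmetric ?_ fun v => ?_
  · rw [hfd]
    intro v w
    have := isSymmetric_expFieldDeriv (a * (p - 1)) μ ((μ - 1) * (p - 1) - 1) x v w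
    simp only [ContinuousLinearMap.coe_coe] at this
    simp only [ContinuousLinearMap.coe_coe, smul_apply, real_inner_smul_left,
      real_inner_smul_right, this]
  · rw [hfd, smul_apply, real_inner_smul_left]
    have h1 := le_inner_expFieldDeriv (b := a * (p - 1)) (s := (μ - 1) * (p - 1) - 1)
      (mul_nonneg ha.le (by linarith)) hμ hx v
    have e1 : Real.exp (a * (p - 1) * ‖x‖ ^ μ) = expPow n a μ x ^ (p - 1) := by
      rw [expPow, ← Real.exp_mul]; ring_nf
    rw [e1, add_sub_cancel] at h1
    rw [mul_assoc]
    exact mul_le_mul_of_nonneg_left h1 hK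

/-- The eigenvalues for `exp (a |x|^μ)` at the origin in the nondegenerate case. -/
theorem pHessEigenvalues_expPow_zero {p a μ : ℝ} (ha : 0 < a) (hμ : 1 < μ)
    (hpμ : (μ - 1) * (p - 1) = 1) :
    Multiset.card (pHessEigenvalues p (expPow n a μ) 0) = n ∧
      ∀ y ∈ pHessEigenvalues p (expPow n a μ) 0, (a * μ) ^ (p - 1) ≤ y := by
  have hfd : fderiv ℝ (pGrad p (expPow n a μ)) 0 =
      (a * μ) ^ (p - 1) • ContinuousLinearMap.id ℝ (E n) := by
    rw [pGrad_expPow ha hμ, hpμ]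
    have h1 : HasFDerivAt (expField n (a * (p - 1)) μ (1 - 1)) (ContinuousLinearMap.id ℝ (E n))
        0 := by
      have h2 := (((hasFDerivAt_norm_rpow (0 : E n) hμ).const_mul (a * (p - 1))).exp).smul
        (hasFDerivAt_id (0 : E n))
      refine (h2.congr_fderiv ?_).congr_of_eventuallyEq ?_
      · ext v
        simp [Real.zero_rpow (by linarith : μ ≠ 0)]
      · filter_upwards with y
        simp [expField]
    exact (h1.const_smul ((a * μ) ^ (p - 1))).fderiv
  refine card_pHessEigenvalues_of_isSymmetric ?_ fun v => ?_
  · rw [hfd]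
    intro v w
    simp [real_inner_smul_left, real_inner_smul_right]
  · rw [hfd, smul_apply, real_inner_smul_left, ContinuousLinearMap.id_apply,
      real_inner_self_eq_norm_sq]

/-! ### Weak derivatives across the origin and Sobolev regularity. -/

/-- The integral of a derivative of a compactly supported continuous function vanishes, even if
differentiability fails at the origin. -/
theorem integral_fderiv_eq_zero_of_differentiable_off_zero {F : E n → ℝ} (hc : Continuous F)
    (hs : HasCompactSupport F) (hd : ∀ x, x ≠ 0 → DifferentiableAt ℝ F x) (j : Fin n)
    (hi : Integrable fun x => fderiv ℝ F x (EuclideanSpace.single j 1)) :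
    ∫ x, fderiv ℝ F x (EuclideanSpace.single j 1) = 0 := by
  obtain ⟨N, rfl⟩ : ∃ N, n = N + 1 := ⟨n - 1, by have := j.isLt; omega⟩
  obtain ⟨R, hR0, hR⟩ := hs.isBounded.exists_pos_norm_lt
  have hzero : ∀ x : E (N + 1), R ≤ ‖x‖ → F x = 0 := fun x hx =>
    image_eq_zero_of_notMem_tsupport fun h => absurd (hR x h) (not_lt.mpr hx)
  let L : (Fin (N + 1) → ℝ) ≃L[ℝ] E (N + 1) := (EuclideanSpace.equiv (Fin (N + 1)) ℝ).symm
  have hLj : ∀ y i, |y i| ≤ ‖L y‖ := fun y i => by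
    simpa [L] using EuclideanSpace.norm_eq (L y) ▸
      Real.abs_le_sqrt (Finset.single_le_sum (f := fun i => ‖L y i‖ ^ 2)
        (fun _ _ => by positivity) (Finset.mem_univ i) |>.trans_eq' (by simp [L]))
  have hmp : MeasurePreserving L := PiLp.volume_preserving_toLp (Fin (N + 1))
  have hemb : MeasurableEmbedding L := L.toHomeomorph.measurableEmbedding
  have hLs : L (Pi.single j 1) = EuclideanSpace.single j 1 := rfl
  rw [← hmp.integral_comp hemb]
  have hi' : Integrable fun y => fderiv ℝ F (L y) (EuclideanSpace.single j 1) :=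
    (hmp.integrable_comp_emb hemb).mpr hi
  -- The field with F as its only component, in direction j, has divergence ∂_j F. The divergence
  -- theorem on the box [-R, R]^n tolerates the countable exceptional set {0}, and the faces
  -- contribute nothing.
  set f : Fin (N + 1) → (Fin (N + 1) → ℝ) → ℝ := fun i y => if i = j then F (L y) else 0 with hf
  set f' : Fin (N + 1) → (Fin (N + 1) → ℝ) → (Fin (N + 1) → ℝ) →L[ℝ] ℝ := fun i y =>
    if i = j then (fderiv ℝ F (L y)).comp (L : (Fin (N + 1) → ℝ) →L[ℝ] E (N + 1)) else 0 with hf'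
  have hsum : ∀ y, ∑ i, f' i y (Pi.single i 1) = fderiv ℝ F (L y) (EuclideanSpace.single j 1) := by
    intro y
    rw [Finset.sum_eq_single j (fun i _ hij => by simp [hf', hij]) (by simp)]
    simp only [hf', if_true, ContinuousLinearMap.comp_apply]
    rw [← hLs]
    rfl
  have key := integral_divergence_of_hasFDerivAt_off_countable' (n := N) (E := ℝ)
    (fun _ => -R) (fun _ => R) (fun _ => by linarith) f f' {0} (countable_singleton 0)
    (fun i => by
      by_cases hij : i = j
      · simp only [hf, hij, if_true]
        exact (hc.comp L.continuous).continuousOn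
      · simp only [hf, hij, if_false]
        exact continuousOn_const)
    (fun x hx i => by
      by_cases hij : i = j
      · simp only [hf, hf', hij, if_true]
        refine (hd (L x) ?_).hasFDerivAt.comp x L.hasFDerivAt
        exact fun h => hx.2 (L.injective (h.trans L.map_zero.symm))
      · simp only [hf, hf', hij, if_false]
        exact hasFDerivAt_const _ _)
    (by simp only [hsum]; exact hi'.integrableOn)
  simp only [hsum] at key
  have hfz : ∀ i y, R ≤ |y i| → f i y = 0 := fun i y hy => by
    by_cases hij : i = j
    · simp only [hf, hij, if_true]
      exact hzero _ (hy.trans (hLj y i))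
    · simp only [hf, hij, if_false]
  rw [Finset.sum_eq_zero (fun i _ => ?_)] at key
  · rw [← key, setIntegral_eq_integral_of_forall_compl_eq_zero]
    intro y hy
    have hnot : L y ∉ tsupport F := by
      intro hmem
      have hlt := hR _ hmem
      refine hy ⟨fun i => ?_, fun i => ?_⟩
      · exact neg_le_of_abs_le ((hLj y i).trans hlt.le)
      · exact le_of_abs_le ((hLj y i).trans hlt.le)
    rw [fderiv_of_notMem_tsupport (𝕜 := ℝ) hnot]
    rfl
  · rw [setIntegral_eq_zero_of_forall_eq_zero, setIntegral_eq_zero_of_forall_eq_zero, sub_zero]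
    · intro y _
      exact hfz _ _ (by simp [abs_of_pos hR0])
    · intro y _
      exact hfz _ _ (by simp [abs_of_pos hR0])

theorem isWeakPartial_fderiv_of_differentiable_off_zero {w : E n → ℝ} (hc : Continuous w)
    (hd : ∀ x, x ≠ 0 → DifferentiableAt ℝ w x) (j : Fin n)
    (hi : LocallyIntegrable fun x => fderiv ℝ w x (EuclideanSpace.single j 1)) :
    IsWeakPartial j w fun x => fderiv ℝ w x (EuclideanSpace.single j 1) := by
  intro φ hφ hφs
  have hφd : Differentiable ℝ φ := hφ.differentiable (by simp)
  have hφ' : Continuous fun x => fderiv ℝ φ x (EuclideanSpace.single j 1) :=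
    (hφ.continuous_fderiv (by simp)).clm_apply continuous_const
  have hn : ∀ᵐ x : E n, x ≠ 0 := by
    have : Nontrivial (E n) := ⟨EuclideanSpace.single j 1, 0, by simp⟩
    exact Measure.ae_ne volume 0
  have hprod : ∀ᵐ x : E n, fderiv ℝ (fun x => w x * φ x) x (EuclideanSpace.single j 1)
      = w x * fderiv ℝ φ x (EuclideanSpace.single j 1)
        + fderiv ℝ w x (EuclideanSpace.single j 1) * φ x := by
    filter_upwards [hn] with x hx
    rw [fderiv_fun_mul (hd x hx) (hφd x)]
    simp only [add_apply, smul_apply, smul_eq_mul]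
    ring
  have hi1 : Integrable fun x => w x * fderiv ℝ φ x (EuclideanSpace.single j 1) :=
    (hc.mul hφ').integrable_of_hasCompactSupport
      ((hφs.fderiv_apply (𝕜 := ℝ) (EuclideanSpace.single j 1)).mul_left)
  have hi2 : Integrable fun x => fderiv ℝ w x (EuclideanSpace.single j 1) * φ x := by
    simpa [mul_comm] using hi.integrable_smul_left_of_hasCompactSupport hφ.continuous hφs
  have h0 := integral_fderiv_eq_zero_of_differentiable_off_zero (hc.mul hφ.continuous)
    hφs.mul_left (fun x hx => (hd x hx).mul (hφd x)) j
    ((integrable_congr hprod).mpr (hi1.add hi2))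
  have h1 := integral_congr_ae hprod
  rw [integral_add hi1 hi2] at h1
  have h2 : ∫ x, fderiv ℝ (fun x => w x * φ x) x (EuclideanSpace.single j 1) = 0 := h0
  linarith

/-- Local integrability of |x|^(-σδ) needs only σδ < n; the bound 1 ≤ n is what the range of δ
supplies, since with σ = 2 - μ it ends at 1/σ. -/
theorem memLpLoc_of_norm_le_rpow (hn : 0 < n) {f : E n → ℝ} (hf : AEStronglyMeasurable f volume)
    {δ σ : ℝ} (hδ : 0 < δ) (hσ : σ * δ < 1)
    (hb : ∀ R, ∃ C, ∀ x : E n, x ≠ 0 → ‖x‖ < R → |f x| ≤ C * ‖x‖ ^ (-σ)) : MemLpLoc f δ := by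
  intro K hK
  obtain ⟨R, -, hR⟩ := hK.isBounded.exists_pos_norm_lt
  obtain ⟨C, hC⟩ := hb R
  have hδ0 : ENNReal.ofReal δ ≠ 0 := by simpa using hδ
  have hnt : Nontrivial (E n) := ⟨EuclideanSpace.single ⟨0, hn⟩ 1, 0, by simp⟩
  rw [← integrable_norm_rpow_iff hf.restrict hδ0 ENNReal.ofReal_ne_top,
    ENNReal.toReal_ofReal hδ.le]
  have hn1 : (1 : ℝ) ≤ n := by exact_mod_cast hn
  have hball : IntegrableOn (fun x => ‖f x‖ ^ δ) (Metric.ball 0 R) volume := by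
    refine integrableOn_ball_of_norm_le_rpow (C := C ^ δ) (α := σ * δ) (by simpa using Nat.one_le_iff_ne_zero.mpr hn.ne')
      (by simpa using hσ.trans_le hn1) ?_ ?_
    · have hne : ∀ᵐ x : E n ∂(volume.restrict (Metric.ball 0 R)), x ≠ 0 :=
        ae_restrict_of_ae (Measure.ae_ne volume 0)
      filter_upwards [hne, ae_restrict_mem measurableSet_ball] with x hx0 hxR
      have h1 := hC x hx0 (mem_ball_zero_iff.mp hxR)
      have hr : 0 < ‖x‖ := norm_pos_iff.mpr hx0
      have hC0 : 0 ≤ C := by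
        have h2 : 0 ≤ C * ‖x‖ ^ (-σ) := (abs_nonneg _).trans h1
        exact nonneg_of_mul_nonneg_left h2 (by positivity)
      rw [Real.norm_of_nonneg (by positivity), Real.norm_eq_abs]
      calc |f x| ^ δ ≤ (C * ‖x‖ ^ (-σ)) ^ δ := by gcongr
        _ = C ^ δ * ‖x‖ ^ (-(σ * δ)) := by
            rw [Real.mul_rpow hC0 (by positivity), ← Real.rpow_mul hr.le, neg_mul]
    · exact (hf.norm.aemeasurable.pow_const δ).aestronglyMeasurable
  exact hball.mono_set fun x hx => mem_ball_zero_iff.mpr (hR x hx)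

theorem memLpLoc_of_continuous (hn : 0 < n) {f : E n → ℝ} (hf : Continuous f) {δ : ℝ}
    (hδ : 0 < δ) : MemLpLoc f δ := by
  refine memLpLoc_of_norm_le_rpow hn hf.aestronglyMeasurable (σ := 0) hδ (by simp) fun R => ?_
  obtain ⟨C, hC⟩ := (isCompact_closedBall (0 : E n) R).exists_bound_of_continuousOn hf.continuousOn
  exact ⟨C, fun x _ hx => by simpa using hC x (mem_closedBall_zero_iff.mpr hx.le)⟩

theorem MemLpLoc.locallyIntegrable {f : E n → ℝ} {δ : ℝ} (hδ : 1 < δ) (h : MemLpLoc f δ) :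
    LocallyIntegrable f := by
  rw [locallyIntegrable_iff]
  intro K hK
  have : IsFiniteMeasure (volume.restrict K) := ⟨by simpa using hK.measure_lt_top⟩
  exact (h K hK).integrable (by simpa using hδ.le)

theorem continuous_fderiv_expPow_apply (a : ℝ) {μ : ℝ} (hμ : 1 < μ) (v : E n) :
    Continuous fun x => fderiv ℝ (expPow n a μ) x v :=
  ((contDiff_expPow a hμ).continuous_fderiv (by norm_num)).clm_apply continuous_const

theorem fderiv_expPow_apply_eq (a : ℝ) {μ : ℝ} (hμ : 1 < μ) (i : Fin n) :
    (fun x => fderiv ℝ (expPow n a μ) x (EuclideanSpace.single i 1))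
      = fun x => (a * μ) * inner ℝ (EuclideanSpace.single i 1) (expField n a μ (μ - 2) x) := by
  funext x
  rw [(hasGradientAt_expPow a hμ x).fderiv_apply, real_inner_comm, real_inner_smul_right]

/-- First derivatives are continuous and second ones are O(|x|^(μ-2)) near 0, so the classical
derivatives off the origin are the weak ones and lie in L^δ_loc. -/
theorem memW2Loc_expPow (hn : 0 < n) {a μ δ : ℝ} (hμ : 1 < μ) (hδ : 1 < δ)
    (hμδ : (2 - μ) * δ < 1) : MemW2Loc (expPow n a μ) δ := by
  have hδ0 : 0 < δ := by linarith
  have hu := contDiff_expPow (n := n) a hμ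
  have hud : Differentiable ℝ (expPow n a μ) := hu.differentiable (by norm_num)
  have hgc : ∀ i, Continuous fun x => fderiv ℝ (expPow n a μ) x (EuclideanSpace.single i 1) :=
    fun i => continuous_fderiv_expPow_apply a hμ _
  have hgL : ∀ i, MemLpLoc (fun x => fderiv ℝ (expPow n a μ) x (EuclideanSpace.single i 1)) δ :=
    fun i => memLpLoc_of_continuous hn (hgc i) hδ0
  have hgd : ∀ i, ∀ x : E n, x ≠ 0 → HasFDerivAt
      (fun x => fderiv ℝ (expPow n a μ) x (EuclideanSpace.single i 1))
      ((a * μ) • (innerSL ℝ (EuclideanSpace.single i 1)).comp (expFieldDeriv a μ (μ - 2) x)) x := by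
    intro i x hx
    rw [fderiv_expPow_apply_eq a hμ i]
    exact (((innerSL ℝ (EuclideanSpace.single i (1 : ℝ))).hasFDerivAt.comp x
      (hasFDerivAt_expField a hμ (μ - 2) hx)).const_mul (a * μ))
  have hhL : ∀ i j, MemLpLoc (fun x => fderiv ℝ
      (fun x => fderiv ℝ (expPow n a μ) x (EuclideanSpace.single i 1)) x
        (EuclideanSpace.single j 1)) δ := by
    intro i j
    refine memLpLoc_of_norm_le_rpow hn (σ := 2 - μ)
      (measurable_fderiv_apply_const ℝ _ _).aestronglyMeasurable hδ0 hμδ fun R => ?_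
    have hcont : Continuous fun x : E n =>
        |a * μ| * (Real.exp (a * ‖x‖ ^ μ) * (1 + |μ - 2 + a * μ * ‖x‖ ^ μ|)) := by
      have h1 : Continuous fun x : E n => ‖x‖ ^ μ :=
        continuous_norm.rpow_const fun _ => Or.inr (by linarith)
      fun_prop
    obtain ⟨C, hC⟩ := (isCompact_closedBall (0 : E n) R).exists_bound_of_continuousOn
      hcont.continuousOn
    refine ⟨C, fun x hx hxR => ?_⟩
    rw [(hgd i x hx).fderiv]
    simp only [smul_apply, ContinuousLinearMap.comp_apply, innerSL_apply_apply, smul_eq_mul]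
    rw [abs_mul, neg_sub]
    have h1 := norm_expFieldDeriv_apply_le a (μ := μ) (s := μ - 2) hx (EuclideanSpace.single j 1)
    have h2 := abs_real_inner_le_norm (EuclideanSpace.single i (1 : ℝ))
      (expFieldDeriv a μ (μ - 2) x (EuclideanSpace.single j 1))
    simp only [PiLp.norm_single, norm_one, one_mul, mul_one] at h1 h2
    have h3 := (le_abs_self _).trans (hC x (mem_closedBall_zero_iff.mpr hxR.le))
    calc |a * μ| * |inner ℝ (EuclideanSpace.single i (1 : ℝ))
          (expFieldDeriv a μ (μ - 2) x (EuclideanSpace.single j 1))|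
        ≤ |a * μ| * (Real.exp (a * ‖x‖ ^ μ) * (1 + |μ - 2 + a * μ * ‖x‖ ^ μ|)
          * ‖x‖ ^ (μ - 2)) := by gcongr; exact h2.trans h1
      _ = |a * μ| * (Real.exp (a * ‖x‖ ^ μ) * (1 + |μ - 2 + a * μ * ‖x‖ ^ μ|))
          * ‖x‖ ^ (μ - 2) := by ring
      _ ≤ C * ‖x‖ ^ (μ - 2) := by gcongr
  refine ⟨memLpLoc_of_continuous hn hu.continuous hδ0, _, _, fun i => ⟨hgL i, ?_⟩,
    fun i j => ⟨hhL i j, ?_⟩⟩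
  · exact isWeakPartial_fderiv_of_differentiable_off_zero hu.continuous (fun x _ => hud x) i
      ((hgL i).locallyIntegrable hδ)
  · exact isWeakPartial_fderiv_of_differentiable_off_zero (hgc i)
      (fun x hx => (hgd i x hx).differentiableAt) j ((hhL i j).locallyIntegrable hδ)

/-! ### Sufficiency. -/

theorem one_le_expPow {a μ : ℝ} (ha : 0 ≤ a) (x : E n) : 1 ≤ expPow n a μ x :=
  Real.one_le_exp (by positivity)

/-- The relation `hμe` translates the thresholds: p ≤ α+β+2 means μ ≥ 2, the Sobolev endpoint is
1/(2-μ), and (p-1)α+β ≥ 0 means that the field exponent (μ-1)(p-1) - 1 is nonnegative. -/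
theorem entireRegularity_expPow {p α β a μ : ℝ} (hn : 0 < n)
    (hβ : β < p - 1) (ha : 0 < a) (hμ : 1 < μ) (hμe : (μ - 1) * (p - 1 - β) = α + 1) :
    EntireRegularity p α β (expPow n a μ) where
  contDiff_one := contDiff_expPow a hμ
  contDiffOn_two := fun x hx => (contDiffAt_expPow a μ hx).contDiffWithinAt
  contDiff_two := fun h => contDiff_two_expPow a (by nlinarith)
  sobolev := fun h _ δ hδ hδ' => by
    refine memW2Loc_expPow hn hμ hδ ?_
    rw [lt_div_iff₀ (by linarith)] at hδ'
    have h1 : (2 - μ) * (p - 1 - β) = p - α - β - 2 := by linarith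
    have h2 : ((2 - μ) * δ) * (p - 1 - β) < 1 * (p - 1 - β) := by
      calc ((2 - μ) * δ) * (p - 1 - β) = δ * ((2 - μ) * (p - 1 - β)) := by ring
        _ < 1 * (p - 1 - β) := by rw [h1]; linarith
    exact lt_of_mul_lt_mul_right h2 (by linarith)
  pGrad_contDiffOn := by
    rw [pGrad_expPow ha hμ]
    exact fun x hx => ((contDiffAt_expField _ _ _ hx).const_smul _).contDiffWithinAt
  pGrad_contDiff := fun h => by
    rw [pGrad_expPow ha hμ]
    refine (contDiff_expField _ hμ ?_).const_smul _
    have h1 : 0 ≤ ((μ - 1) * (p - 1) - 1) * (p - 1 - β) := by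
      have : ((μ - 1) * (p - 1) - 1) * (p - 1 - β) = (p - 1) * α + β := by
        linear_combination (p - 1) * hμe
      rw [this]; exact h
    exact nonneg_of_mul_nonneg_left h1 (by linarith)

/-- The pointwise inequality for `exp (a |x|^μ)`. -/
theorem expPow_pointwise {p α β d A u r μ κ : ℝ} (hA : 0 < A) (hu : 1 ≤ u) (hr : 0 < r)
    (hd : d ≤ p - 1 - β) (hμe : (μ - 1) * (p - 1 - β) = α + 1)
    (hκ : 1 ≤ A ^ (p - 1 - β) * κ) :
    r ^ α * (A * (u * r ^ (μ - 1))) ^ β * u ^ d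
      ≤ A ^ (p - 1) * (u ^ (p - 1) * r ^ ((μ - 1) * (p - 1) - 1) * κ) := by
  have hu0 : 0 < u := by linarith
  have e1 : A ^ (p - 1) = A ^ β * A ^ (p - 1 - β) := by rw [← Real.rpow_add hA]; ring_nf
  have e2 : u ^ (p - 1) = u ^ β * u ^ (p - 1 - β) := by rw [← Real.rpow_add hu0]; ring_nf
  have e3 : r ^ ((μ - 1) * (p - 1) - 1) = r ^ α * r ^ ((μ - 1) * β) := by
    rw [← Real.rpow_add hr]
    congr 1
    linear_combination hμe
  rw [Real.mul_rpow hA.le (by positivity), Real.mul_rpow hu0.le (by positivity),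
    ← Real.rpow_mul hr.le, e1, e2, e3]
  calc r ^ α * (A ^ β * (u ^ β * r ^ ((μ - 1) * β))) * u ^ d
      -- The growth condition on d is used here, together with u ≥ 1.
      ≤ r ^ α * (A ^ β * (u ^ β * r ^ ((μ - 1) * β))) * u ^ (p - 1 - β) := by
        gcongr
    _ ≤ r ^ α * (A ^ β * (u ^ β * r ^ ((μ - 1) * β))) * u ^ (p - 1 - β)
        * (A ^ (p - 1 - β) * κ) := le_mul_of_one_le_right (by positivity) hκ
    _ = _ := by ring

/-- Existence, for any operator which is bounded below by the least eigenvalue on the positive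
orthant. -/
theorem hasNonnegNontrivialSubsolution {p α β d : ℝ} {cone : Set (Multiset ℝ)}
    {F : Multiset ℝ → ℝ} (hn : 0 < n) (hp : 1 < p) (hα : -1 < α) (hβ : β < p - 1)
    (hd : d ≤ p - β - 1)
    (hF : ∀ m > 0, ∀ l : Multiset ℝ, Multiset.card l = n → (∀ y ∈ l, m ≤ y) →
      l ∈ cone ∧ m ≤ F l) :
    HasNonnegNontrivialSubsolution n p α β (powerNonlin d) cone F := by
  have he : 0 < p - 1 - β := by linarith
  have hp1 : 0 < p - 1 := by linarith
  -- Balances |x|^α |x|^((μ-1)β) against |x|^((μ-1)(p-1)-1); μ > 1 because α > -1.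
  obtain ⟨μ, hμdef⟩ : ∃ μ, μ = 1 + (α + 1) / (p - 1 - β) := ⟨_, rfl⟩
  have hμe : (μ - 1) * (p - 1 - β) = α + 1 := by rw [hμdef]; field_simp; ring
  have hμ : 1 < μ := by
    have : 0 < (α + 1) / (p - 1 - β) := div_pos (by linarith) he
    linarith
  obtain ⟨κ, hκ⟩ : ∃ κ, κ = min 1 ((μ - 1) * (p - 1)) := ⟨_, rfl⟩
  have hκ0 : 0 < κ := by rw [hκ]; exact lt_min one_pos (mul_pos (by linarith) hp1)
  have hκ1 : κ ≤ 1 := hκ ▸ min_le_left _ _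
  -- With A = aμ the operator scales as A^(p-1) and the right side as A^β, so A^(p-1-β) = 1/κ
  -- absorbs the ellipticity constant κ.
  obtain ⟨A, hA⟩ : ∃ A, A = (1 / κ) ^ (1 / (p - 1 - β)) := ⟨_, rfl⟩
  have hA1 : 1 ≤ A := hA ▸ Real.one_le_rpow ((one_le_div hκ0).mpr hκ1) (by positivity)
  have hAe : 1 ≤ A ^ (p - 1 - β) * κ := by
    rw [hA, ← Real.rpow_mul (by positivity), one_div_mul_cancel he.ne', Real.rpow_one,
      one_div_mul_cancel hκ0.ne']
  have ha : 0 < A / μ := by positivity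
  have haμ : A / μ * μ = A := by field_simp
  have hAp : 1 ≤ A ^ (p - 1) := Real.one_le_rpow hA1 hp1.le
  have hoff : ∀ x : E n, x ≠ 0 → pHessEigenvalues p (expPow n (A / μ) μ) x ∈ cone ∧
      A ^ (p - 1) * (expPow n (A / μ) μ x ^ (p - 1) * ‖x‖ ^ ((μ - 1) * (p - 1) - 1) * κ)
        ≤ F (pHessEigenvalues p (expPow n (A / μ) μ) x) := by
    intro x hx
    have hr : 0 < ‖x‖ := norm_pos_iff.mpr hx
    have hE : 0 < expPow n (A / μ) μ x := Real.exp_pos _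
    obtain ⟨h1, h2⟩ := pHessEigenvalues_expPow hp ha hμ hx
    rw [haμ, ← hκ] at h2
    exact hF _ (by positivity) _ h1 h2
  -- When α = β = 0, (μ-1)(p-1) = 1, so the derivative of the `p`-gradient at 0 is a multiple of the
  -- identity.
  have hzero : α = 0 ∧ β = 0 → pHessEigenvalues p (expPow n (A / μ) μ) 0 ∈ cone ∧
      A ^ (p - 1) ≤ F (pHessEigenvalues p (expPow n (A / μ) μ) 0) := by
    rintro ⟨rfl, rfl⟩
    obtain ⟨h1, h2⟩ := pHessEigenvalues_expPow_zero (n := n) (p := p) ha hμ (by linarith)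
    rw [haμ] at h2
    exact hF _ (by positivity) _ h1 h2
  refine ⟨expPow n (A / μ) μ,
    { regular := entireRegularity_expPow hn hβ ha hμ hμe
      admissible := fun x hx => ?_
      rhs_finite := fun x hx _ _ => ?_
      subsolution := fun x hx => ?_ }, fun x => (Real.exp_pos _).le,
    0, (Real.exp_pos _).ne'⟩
  · rcases eq_or_ne x 0 with rfl | h
    · exact (hzero (hx.resolve_left (by simp))).1
    · exact (hoff x h).1
  · have hr : 0 < ‖x‖ := norm_pos_iff.mpr hx
    have hE : 0 < expPow n (A / μ) μ x := Real.exp_pos _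
    rw [← norm_pos_iff, norm_gradient_expPow ha hμ hx]
    positivity
  · have hE : 0 < expPow n (A / μ) μ x := Real.exp_pos _
    rw [powerNonlin, if_pos hE]
    rcases eq_or_ne x 0 with rfl | h
    · have h0 := hx.resolve_left (by simp)
      refine le_trans ?_ (hzero h0).2
      obtain ⟨rfl, rfl⟩ := h0
      have h1 : expPow n (A / μ) μ 0 = 1 := by
        simp [expPow, Real.zero_rpow (by linarith : μ ≠ 0)]
      rw [h1, Real.rpow_zero, Real.rpow_zero, Real.one_rpow, one_mul, one_mul]
      exact hAp
    · refine le_trans ?_ (hoff x h).2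
      rw [norm_gradient_expPow ha hμ h, haμ]
      exact expPow_pointwise (by linarith) (one_le_expPow ha.le x) (norm_pos_iff.mpr h)
        (by linarith) hμe hAe

end HessianSub

end

theorem corollary1p2 (n k : ℕ) (hk : 1 ≤ k) (hkn : k ≤ n) (p α β d : ℝ)
    (hp : 1 < p) (hβ : β < p - 1) (hd : 0 ≤ d) :
    (HessianSub.ExponentCondition (1 / (k : ℝ) - 1) p α β →
      (HessianSub.HasNonnegNontrivialSubsolution n p α β (HessianSub.powerNonlin d)
          (HessianSub.gardingCone n k) (HessianSub.hessOp k) ↔ d ≤ p - β - 1)) ∧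
    (HessianSub.ExponentCondition ((k : ℝ) / (n : ℝ) - 1) p α β →
      (HessianSub.HasNonnegNontrivialSubsolution n p α β (HessianSub.powerNonlin d)
          (HessianSub.sumCone n k) (HessianSub.piOp n k) ↔ d ≤ p - β - 1)) := by
  have hn : 0 < n := by omega
  have hk0 : (0 : ℝ) < k := by exact_mod_cast hk
  have hn0 : (0 : ℝ) < n := by exact_mod_cast hn
  refine ⟨fun hcond => ?_, fun hcond => ?_⟩
  · have hα := HessianSub.neg_one_lt_of_exponentCondition
      (by linarith [div_pos one_pos hk0]) hcond
    refine ⟨fun h => ?_, fun h => ?_⟩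
    · have hC : 0 < (n.choose k : ℝ) ^ (1 / (k : ℝ)) := by
        have : (0 : ℝ) < n.choose k := by exact_mod_cast Nat.choose_pos hkn
        positivity
      exact HessianSub.le_of_hasNonnegNontrivialSubsolution hp hn hα hβ hC
        (fun l hl => ⟨hl.1, HessianSub.hessOp_le_sum hk hl⟩) h
    · exact HessianSub.hasNonnegNontrivialSubsolution hn hp hα hβ h fun m hm l hl hy =>
        HessianSub.mem_gardingCone_of_le hk hkn hm hl hy
  · have hα := HessianSub.neg_one_lt_of_exponentCondition
      (by linarith [div_pos hk0 hn0]) hcond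
    refine ⟨fun h => ?_, fun h => ?_⟩
    · have hC : 0 < ((n - 1).choose (k - 1) : ℝ) := by
        exact_mod_cast Nat.choose_pos (by omega)
      exact HessianSub.le_of_hasNonnegNontrivialSubsolution hp hn hα hβ hC
        (fun l hl => ⟨hl.1, HessianSub.piOp_le_sum hk hkn hl⟩) h
    · exact HessianSub.hasNonnegNontrivialSubsolution hn hp hα hβ h fun m hm l hl hy =>
        HessianSub.mem_sumCone_of_le hk hkn hm hl hy
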